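/- \textbf{Conventions.} A PI space is a complete metric space $X$ with a Borel measure $\mu$, finite and positive on balls, for which there are $\lambda\in[1,\infty)$ and, for every $R>0$, constants $\beta(R),\tau(R)<\infty$ such that for all $x\in X$ and $0<r\le R$ $$\mu(B_{2r}(x))\le\beta(R)\,\mu(B_r(x)),\qquad \int_{B_r(x)}|u-u_{x,r}|\,d\mu\le r\,\tau(R)\int_{B_{\lambda r}(x)}\rho\,d\mu$$ whenever $u:X\to\mathbb R$ is locally integrable with mean $u_{x,r}$ over $B_r(x)$ and $\rho$ is an upper gradient of $u$, that is, $\rho:X\to[0,\infty]$ is Borel and $|u(\gamma(\ell))-u(\gamma(0))|\le\int_0^\ell\rho(\gamma(s))\,ds$ for every curve $\gamma:[0,\ell]\to X$ parametrized by arclength. Put $\kappa=\beta(1)$, $\tau=\tau(1)$. For an open set $U\subset X$, a Banach space $V$ and $h\in L^1(U,V)$ let $$\operatorname{VAR}(h,U)=\inf_{(h_i)}\ \liminf_{i\to\infty}\int_U\operatorname{Lip}h_i\,d\mu,\qquad \operatorname{Lip}k(x)=\liminf_{r\to0}\ \sup_{d(x,x')<r}\frac{\|k(x)-k(x')\|}{r},$$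 where the infimum is over all sequences of locally Lipschitz maps $h_i:U\to V$ with $h_i\to h$ in $L^1(U,V)$. We write $h\in\operatorname{BV}(U,V)$ if some such sequence has $\liminf_i\int_U\operatorname{Lip}h_i\,d\mu<\infty$, and $\operatorname{BV}(U)=\operatorname{BV}(U,\mathbb R)$. Let $(Y,\nu)$ be a $\sigma$-finite measure space and $L^1(Y)=L^1(Y,\nu)$. Given $f\in L^1(U,L^1(Y))$, let $H\in L^1(U\times Y)$ be the (a.e. unique) function with $H(x,\cdot)=f(x)$ in $L^1(Y)$ for a.e. $x\in U$, and put $g(y)=H(\cdot,y)$ if $H(\cdot,y)\in L^1(U)$ and $g(y)=0$ otherwise. The total variation of $f$ is $\int_Y\operatorname{VAR}(g(y),U)\,d\nu(y)\in[0,\infty]$, and $f$ has finite total variation if $g(y)\in\operatorname{BV}(U)$ for $\nu$-a.e. $y$ and the total variation is finite. \textbf{Theorem.} There is a constant $c=c(\kappa,\tau,\lambda)\in(0,\infty)$, depending only on $\kappa$, $\tau$ and $\lambda$, such that for every PI space $X$ with these constants, every open $U\subset X$, every $\sigma$-finite measure space $(Y,\nu)$ and every $f\in L^1(U,L^1(Y))$: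 $f\in\operatorname{BV}(U,L^1(Y))$ if and only if $f$ has finite total variation, and $$c^{-1}\operatorname{VAR}(f,U)\le\int_Y\operatorname{VAR}(g(y),U)\,d\nu(y)\le c\operatorname{VAR}(f,U).$$ -/

import Mathlib

open MeasureTheory Filter Topology Set
open scoped ENNReal NNReal

universe u v

namespace BVSlices

/-! ### PI spaces -/

section PISpaces

variable {X : Type u} [MetricSpace X] [MeasurableSpace X]

/-- `g` is an upper gradient of `f`: it is Borel and, for every curve `γ : [0, ℓ] → X`
parametrized by arclength, `|f (γ ℓ) - f (γ 0)| ≤ ∫₀^ℓ g (γ s) ds`. -/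
def IsUpperGradient (g : X → ℝ≥0∞) (f : X → ℝ) : Prop :=
  Measurable g ∧ ∀ (ℓ : ℝ) (γ : ℝ → X), 0 ≤ ℓ → HasUnitSpeedOn γ (Icc 0 ℓ) →
    ENNReal.ofReal |f (γ ℓ) - f (γ 0)| ≤ ∫⁻ s in Icc 0 ℓ, g (γ s)

/-- `(X, d, μ)` is a PI space: `X` is complete, balls have positive finite measure, and at all
scales `r ≤ R` the measure is doubling with constant `β R` and satisfies the `(1,1)`-Poincaré
inequality with constant `τ R` and dilation factor `lam`. -/
structure IsPISpace (μ : Measure X) (β τ : ℝ → ℝ≥0) (lam : ℝ) : Prop where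
  complete : CompleteSpace X
  ball_pos : ∀ (x : X) (r : ℝ), 0 < r → 0 < μ (Metric.ball x r)
  ball_lt_top : ∀ (x : X) (r : ℝ), μ (Metric.ball x r) < ∞
  doubling : ∀ (R r : ℝ) (x : X), 0 < r → r ≤ R →
    μ (Metric.ball x (2 * r)) ≤ β R * μ (Metric.ball x r)
  one_le_dilation : 1 ≤ lam
  poincare : ∀ (R r : ℝ) (x : X) (f : X → ℝ) (g : X → ℝ≥0∞), 0 < r → r ≤ R →
    LocallyIntegrable f μ → IsUpperGradient g f →
    ∫⁻ z in Metric.ball x r, ENNReal.ofReal |f z - ⨍ w in Metric.ball x r, f w ∂μ| ∂μ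
      ≤ ENNReal.ofReal r * τ R * ∫⁻ z in Metric.ball x (lam * r), g z ∂μ

end PISpaces

/-! ### Functions of bounded variation -/

section BV

variable {X : Type u} [MetricSpace X] {V : Type*} [NormedAddCommGroup V]

/-- The pointwise Lipschitz constant
`Lip h (x) = liminf_{r → 0} sup_{d(x,x') < r} d(h x, h x') / r`. It depends only on `h` near `x`,
so that at a point of an open set `U` it depends only on the restriction of `h` to `U`. -/
noncomputable def pointwiseLip (h : X → V) (x : X) : ℝ≥0∞ :=
  liminf (fun r : ℝ => (⨆ x' ∈ Metric.ball x r, edist (h x) (h x')) / ENNReal.ofReal r) (𝓝[>] 0)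

variable [MeasurableSpace X]

/-- `hs` is a sequence of maps, locally Lipschitz on `U`, that converges to `h` in `L¹(U, V)`. -/
def IsLipApprox (μ : Measure X) (U : Set X) (h : X → V) (hs : ℕ → X → V) : Prop :=
  (∀ i, LocallyLipschitzOn U (hs i)) ∧
    Tendsto (fun i => ∫⁻ x in U, ‖hs i x - h x‖ₑ ∂μ) atTop (𝓝 0)

/-- `h` belongs to `BV(U, V)`. -/
def IsBV (μ : Measure X) (U : Set X) (h : X → V) : Prop :=
  IntegrableOn h U μ ∧ ∃ hs : ℕ → X → V, IsLipApprox μ U h hs ∧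
    liminf (fun i => ∫⁻ x in U, pointwiseLip (hs i) x ∂μ) atTop < ∞

/-- The variation `VAR(h, U)`, equal to `∞` when `h` is not in `BV(U, V)`. -/
noncomputable def variation (μ : Measure X) (U : Set X) (h : X → V) : ℝ≥0∞ :=
  ⨅ (hs : ℕ → X → V) (_ : IsLipApprox μ U h hs),
    liminf (fun i => ∫⁻ x in U, pointwiseLip (hs i) x ∂μ) atTop

end BV

/-! ### Interchanging variables: `L¹(Ω, L¹(Y)) = L¹(Ω × Y)` -/

section Interchange

variable {Ω : Type u} [MeasurableSpace Ω] {Y : Type v} [MeasurableSpace Y]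
  {m : Measure Ω} {ν : Measure Y} [SFinite ν]

/-- `H ∈ L¹(Ω × Y)` represents `f : Ω → L¹(Y)`: for a.e. `x`, `H (x, ·) = f x` in `L¹(Y)`. -/
def Represents (m : Measure Ω) (ν : Measure Y) (H : Ω × Y → ℝ) (f : Ω → (Y →₁[ν] ℝ)) : Prop :=
  Integrable H (m.prod ν) ∧ ∀ᵐ x ∂m, (fun y => H (x, y)) =ᵐ[ν] f x

theorem Represents.lintegral_sub {H K : Ω × Y → ℝ} {f g : Ω → (Y →₁[ν] ℝ)}
    (hH : Represents m ν H f) (hK : Represents m ν K g) :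
    ∫⁻ z, ‖H z - K z‖ₑ ∂(m.prod ν) = ∫⁻ x, ‖f x - g x‖ₑ ∂m := by
  have hm : AEMeasurable (fun z => ‖H z - K z‖ₑ) (m.prod ν) :=
    (hH.1.sub hK.1).aestronglyMeasurable.enorm
  rw [lintegral_prod _ hm]
  refine lintegral_congr_ae ?_
  filter_upwards [hH.2, hK.2] with x h1 h2
  rw [Lp.enorm_def, eLpNorm_one_eq_lintegral_enorm]
  refine lintegral_congr_ae ?_
  filter_upwards [h1, h2, Lp.coeFn_sub (f x) (g x)] with y a b e
  simp only [e, Pi.sub_apply, a, b]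

theorem exists_represents {f : Ω → (Y →₁[ν] ℝ)} (hf : Integrable f m) :
    ∃ H : Ω × Y → ℝ, Represents m ν H f := by
  refine Integrable.induction (P := fun f : Ω → (Y →₁[ν] ℝ) => ∃ H, Represents m ν H f)
    ?_ ?_ ?_ ?_ hf
  · intro c s hs hms
    refine ⟨fun z => s.indicator (fun _ => (1 : ℝ)) z.1 * c z.2, ?_, ?_⟩
    · exact ((integrable_indicator_iff hs).2
        (integrableOn_const hms.ne)).mul_prod (L1.integrable_coeFn c)
    · refine Eventually.of_forall fun x => ?_
      by_cases hx : x ∈ s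
      · simp [hx]
      · simp only [hx, not_false_eq_true, indicator_of_notMem, zero_mul]
        exact (Lp.coeFn_zero ℝ 1 ν).symm
  · rintro f g - - - ⟨H, hH⟩ ⟨K, hK⟩
    refine ⟨H + K, hH.1.add hK.1, ?_⟩
    filter_upwards [hH.2, hK.2] with x h1 h2
    filter_upwards [h1, h2, Lp.coeFn_add (f x) (g x)] with y a b e
    refine Eq.trans ?_ e.symm
    simp only [Pi.add_apply, a, b]
  · refine IsSeqClosed.isClosed ?_
    intro F f hF hlim
    choose H hH using hF
    have key : ∀ i j, edist ((hH i).1.toL1) ((hH j).1.toL1) = edist (F i) (F j) := by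
      intro i j
      rw [Integrable.edist_toL1_toL1, L1.edist_def]
      simp only [edist_eq_enorm_sub]
      exact (hH i).lintegral_sub (hH j)
    have hc : CauchySeq fun i => (hH i).1.toL1 := by
      rw [EMetric.cauchySeq_iff]
      intro ε hε
      obtain ⟨N, hN⟩ := EMetric.cauchySeq_iff.1 hlim.cauchySeq ε hε
      exact ⟨N, fun a ha b hb => by rw [key]; exact hN a ha b hb⟩
    obtain ⟨G, hG⟩ := cauchySeq_tendsto_of_complete hc
    have hGi : Integrable G (m.prod ν) := L1.integrable_coeFn G
    refine ⟨G, hGi, ?_⟩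
    -- the bounds `B i x`, whose integrals tend to zero
    set B : ℕ → Ω → ℝ≥0∞ := fun i x =>
      (∫⁻ y, ‖G (x, y) - H i (x, y)‖ₑ ∂ν) + ‖F i x - f x‖ₑ with hB
    have hm1 : ∀ i, AEMeasurable (fun z => ‖G z - H i z‖ₑ) (m.prod ν) := fun i =>
      (hGi.sub (hH i).1).aestronglyMeasurable.enorm
    have hm2 : ∀ i, AEMeasurable (fun x => ‖F i x - f x‖ₑ) m := fun i =>
      ((Lp.aestronglyMeasurable (F i)).sub (Lp.aestronglyMeasurable f)).enorm
    have hm3 : ∀ i, AEMeasurable (fun x => ∫⁻ y, ‖G (x, y) - H i (x, y)‖ₑ ∂ν) m := fun i =>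
      (hm1 i).lintegral_prod_right'
    have hBint : ∀ i, ∫⁻ x, B i x ∂m = edist ((hH i).1.toL1) G + edist (F i) f := by
      intro i
      rw [lintegral_add_left' (hm3 i), ← lintegral_prod _ (hm1 i), L1.edist_def (F i) f,
        edist_comm, L1.edist_def]
      simp only [edist_eq_enorm_sub]
      congr 1
      refine lintegral_congr_ae ?_
      filter_upwards [(hH i).1.coeFn_toL1] with z hz
      rw [hz]
    have hB0 : Tendsto (fun i => ∫⁻ x, B i x ∂m) atTop (𝓝 0) := by
      simp only [hBint]
      simpa using (tendsto_iff_edist_tendsto_0.1 hG).add (tendsto_iff_edist_tendsto_0.1 hlim)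
    have hBm : ∀ i, AEMeasurable (B i) m := fun i => (hm3 i).add (hm2 i)
    have hlim0 : ∫⁻ x, liminf (fun i => (hBm i).mk (B i) x) atTop ∂m = 0 := by
      refine le_antisymm ((lintegral_liminf_le fun i => (hBm i).measurable_mk).trans ?_) zero_le
      have : ∀ i, ∫⁻ x, (hBm i).mk (B i) x ∂m = ∫⁻ x, B i x ∂m := fun i =>
        lintegral_congr_ae (hBm i).ae_eq_mk.symm
      simp only [this]
      rw [hB0.liminf_eq]
    have hae := (lintegral_eq_zero_iff
      (Measurable.liminf fun i => (hBm i).measurable_mk)).1 hlim0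
    have hmk : ∀ᵐ x ∂m, ∀ i, B i x = (hBm i).mk (B i) x :=
      ae_all_iff.2 fun i => (hBm i).ae_eq_mk
    have hle : ∀ᵐ x ∂m, ∀ i, ∫⁻ y, ‖G (x, y) - f x y‖ₑ ∂ν ≤ B i x := by
      rw [ae_all_iff]
      intro i
      filter_upwards [(hH i).2, hGi.aestronglyMeasurable.prodMk_left,
        (hH i).1.aestronglyMeasurable.prodMk_left] with x hx g1 g2
      rw [hB]
      simp only
      have hm : AEMeasurable (fun y => ‖G (x, y) - H i (x, y)‖ₑ) ν := (g1.sub g2).enorm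
      rw [Lp.enorm_def, eLpNorm_one_eq_lintegral_enorm, ← lintegral_add_left' hm]
      refine lintegral_mono_ae ?_
      filter_upwards [hx, Lp.coeFn_sub (F i x) (f x)] with y h1 h2
      rw [h2, Pi.sub_apply, ← h1]
      calc ‖G (x, y) - f x y‖ₑ
          = ‖(G (x, y) - H i (x, y)) + (H i (x, y) - f x y)‖ₑ := by rw [sub_add_sub_cancel]
        _ ≤ _ := enorm_add_le _ _
    filter_upwards [hae, hmk, hle, hGi.aestronglyMeasurable.prodMk_left] with x h0 he h1 h2
    have h3 : ∫⁻ y, ‖G (x, y) - f x y‖ₑ ∂ν = 0 := by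
      refine le_antisymm ?_ zero_le
      calc _ ≤ liminf (fun i => B i x) atTop :=
            le_liminf_of_le (by isBoundedDefault) (Eventually.of_forall h1)
        _ = 0 := by simp only [he]; exact h0
    have h4 := (lintegral_eq_zero_iff' (h2.sub (Lp.aestronglyMeasurable (f x))).enorm).1 h3
    filter_upwards [h4] with y hy
    simpa [sub_eq_zero] using hy
  · rintro f g hfg - ⟨H, hH⟩
    refine ⟨H, hH.1, ?_⟩
    filter_upwards [hH.2, hfg] with x h1 h2
    rw [← h2]
    exact h1

/-- The function `H ∈ L¹(Ω × Y)` with `H (x, ·) = f x` for a.e. `x`; by Fubini's theorem it is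
unique up to a null set of `Ω × Y`. -/
noncomputable def jointRep (f : Ω →₁[m] (Y →₁[ν] ℝ)) : Ω × Y → ℝ :=
  Classical.choose (exists_represents (L1.integrable_coeFn f))

theorem jointRep_spec (f : Ω →₁[m] (Y →₁[ν] ℝ)) : Represents m ν (jointRep f) f :=
  Classical.choose_spec (exists_represents (L1.integrable_coeFn f))

open Classical in
/-- The slice `g(y)`: it is `H (·, y)` if this function is in `L¹(Ω)`, and `0` otherwise. -/
noncomputable def slice (f : Ω →₁[m] (Y →₁[ν] ℝ)) (y : Y) : Ω → ℝ :=
  if Integrable (fun x => jointRep f (x, y)) m then fun x => jointRep f (x, y) else 0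

end Interchange

/-! ### Total variation -/

section TotalVariation

variable {X : Type u} [MetricSpace X] [MeasurableSpace X] {Y : Type v} [MeasurableSpace Y]
  {μ : Measure X} {ν : Measure Y} [SigmaFinite ν] {U : Set X}

/-- The total variation `∫_Y VAR(g(y), U) dν` of `f ∈ L¹(U, L¹(Y))`. -/
noncomputable def totalVariation (f : X →₁[μ.restrict U] (Y →₁[ν] ℝ)) : ℝ≥0∞ :=
  ∫⁻ y, variation μ U (slice f y) ∂ν

/-- `f` has finite total variation. -/
def HasFiniteTotalVariation (f : X →₁[μ.restrict U] (Y →₁[ν] ℝ)) : Prop :=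
  (∀ᵐ y ∂ν, IsBV μ U (slice f y)) ∧ totalVariation f < ∞

end TotalVariation

end BVSlices

/-! The variation is defined by relaxation and cannot be sliced directly, but a double integral of
‖h z - h x‖ can. For a positive scale s on U, let E_s(h) be the integral over U × U of ‖h z - h x‖
against `scaleKernel`. When V = L¹(Y) the norm is itself an integral over Y, so Tonelli gives the
exact identity E_s(f) = ∫ E_s(g(y)) dν (`kernelEnergy_eq_lintegral_slice`).

It remains to compare E_s with VAR for a general Banach target, since the comparison is used both
for L¹(Y) and for ℝ. The bound E_s ≤ C₁ VAR is `kernelEnergy_scaleKernel_le_variation`. For locally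
Lipschitz F, the real-valued Poincaré inequality is applied to truncations of ‖F - F z‖; telescoping
over dyadic balls bounds ‖F x - F z‖ by potentials of Lip F, which are bounded on L¹. Lower
semicontinuity of E_s in L¹ extends the bound to all h. The bound VAR ≤ C₂ liminf E_{s_n}, for
scales tending to 0, is `variation_le_liminf_kernelEnergy`: weighted means of h at scale s_n are
competitors in the relaxation.

Both inequalities between VAR(f) and the total variation follow, one of them through Fatou's lemma
on Y. The scales shrink towards the complement of U, so every ball used stays inside U and no
regularity of U is needed. -/

namespace BVSlices

/-! ### The pointwise Lipschitz constant -/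

section PointwiseLip

variable {X : Type u} [MetricSpace X] {V W : Type*} [NormedAddCommGroup V] [NormedAddCommGroup W]

theorem pointwiseLip_mono {h : X → V} {k : X → W} {x : X}
    (hk : ∀ᶠ x' in 𝓝 x, edist (h x) (h x') ≤ edist (k x) (k x')) :
    pointwiseLip h x ≤ pointwiseLip k x := by
  obtain ⟨ε, hε, hb⟩ := Metric.eventually_nhds_iff_ball.1 hk
  refine liminf_le_liminf ?_
  filter_upwards [Ioo_mem_nhdsGT hε] with r hr
  refine ENNReal.div_le_div_right (iSup₂_mono fun x' hx' => hb x' ?_) _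
  exact Metric.ball_subset_ball hr.2.le hx'

theorem pointwiseLip_le_of_eventually {h : X → V} {x : X} {K : ℝ≥0∞}
    (hk : ∀ᶠ x' in 𝓝 x, edist (h x) (h x') ≤ K * edist x x') : pointwiseLip h x ≤ K := by
  obtain ⟨ε, hε, hb⟩ := Metric.eventually_nhds_iff_ball.1 hk
  refine liminf_le_of_frequently_le' (Eventually.frequently ?_)
  filter_upwards [Ioo_mem_nhdsGT hε] with r hr
  refine ENNReal.div_le_of_le_mul (iSup₂_le fun x' hx' => ?_)
  refine (hb x' (Metric.ball_subset_ball hr.2.le hx')).trans ?_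
  gcongr
  rw [edist_comm, edist_dist]
  exact ENNReal.ofReal_le_ofReal (Metric.mem_ball.1 hx').le

/-- The pointwise Lipschitz constant at a point of an open set in terms of rational radii. -/
theorem pointwiseLip_eq_iSup_iInf_rat {U : Set X} (hU : IsOpen U) (h : X → V) {x : X}
    (hx : x ∈ U) :
    pointwiseLip h x = ⨆ (d : ℚ) (_ : 0 < d), ⨅ (q : ℚ) (_ : q ∈ Ioo 0 d),
      (⨆ x' ∈ Metric.ball x (q : ℝ) ∩ U, edist (h x) (h x')) / ENNReal.ofReal q := by
  obtain ⟨ε, hε, hεU⟩ := Metric.isOpen_iff.1 hU x hx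
  set S : ℝ → ℝ≥0∞ := fun r => ⨆ x' ∈ Metric.ball x r ∩ U, edist (h x) (h x') with hS
  have hmono : Monotone S := fun a b hab =>
    iSup₂_le fun x' hx' => le_iSup₂_of_le x' ⟨Metric.ball_subset_ball hab hx'.1, hx'.2⟩ le_rfl
  have h1 : pointwiseLip h x = liminf (fun r => S r / ENNReal.ofReal r) (𝓝[>] 0) := by
    refine liminf_congr ?_
    filter_upwards [Ioo_mem_nhdsGT hε] with r hr
    rw [hS]
    simp only
    rw [inter_eq_left.2 ((Metric.ball_subset_ball hr.2.le).trans hεU)]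
  rw [h1, (nhdsGT_basis (0 : ℝ)).liminf_eq_iSup_iInf]
  refine le_antisymm ?_ ?_
  · refine iSup₂_le fun d hd => ?_
    obtain ⟨d', hd', hdd⟩ := exists_rat_btwn hd
    refine le_iSup₂_of_le d' (by exact_mod_cast hd') ?_
    refine le_iInf₂ fun q hq => iInf₂_le_of_le (q : ℝ) ⟨by exact_mod_cast hq.1, ?_⟩ le_rfl
    exact lt_trans (by exact_mod_cast hq.2) hdd
  · refine iSup₂_le fun d hd => le_iSup₂_of_le (d : ℝ) (by exact_mod_cast hd) ?_
    refine le_iInf₂ fun r hr => ?_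
    set a := ⨅ (q : ℚ) (_ : q ∈ Ioo 0 d), S q / ENNReal.ofReal q with ha
    have hr0 : ENNReal.ofReal r ≠ 0 := by simpa using hr.1
    rw [ENNReal.le_div_iff_mul_le (Or.inl hr0) (Or.inl ENNReal.ofReal_ne_top)]
    -- If S r < a * r, then also S r < a * q for all q slightly below r. A rational such q
    -- contradicts a ≤ S q / q together with S q ≤ S r.
    by_contra! hlt
    have ht : Tendsto (fun q : ℝ => a * ENNReal.ofReal q) (𝓝 r) (𝓝 (a * ENNReal.ofReal r)) :=
      ENNReal.Tendsto.const_mul (ENNReal.continuous_ofReal.tendsto r) (Or.inl hr0)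
    have hev : ∀ᶠ q in 𝓝[<] r, S r < a * ENNReal.ofReal q :=
      (ht.eventually (lt_mem_nhds hlt)).filter_mono nhdsWithin_le_nhds
    obtain ⟨l, hl, hsub⟩ := (mem_nhdsLT_iff_exists_Ioo_subset).1 hev
    obtain ⟨q, hq1, hq2⟩ := exists_rat_btwn (max_lt hr.1 hl)
    have hq0 : (0 : ℝ) < q := (le_max_left _ _).trans_lt hq1
    have hlt' : S r < a * ENNReal.ofReal q := hsub ⟨(le_max_right _ _).trans_lt hq1, hq2⟩
    refine hlt'.not_ge ?_
    have : a ≤ S q / ENNReal.ofReal q := iInf₂_le q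
      ⟨by exact_mod_cast hq0, by exact_mod_cast hq2.trans hr.2⟩
    calc a * ENNReal.ofReal q ≤ S q / ENNReal.ofReal q * ENNReal.ofReal q := by gcongr
      _ ≤ S q := (ENNReal.div_mul_cancel (by simpa using hq0) ENNReal.ofReal_ne_top).le
      _ ≤ S r := hmono hq2.le

/-- Since γ is 1-Lipschitz, the right difference quotient of u ∘ γ with step r is at most the
oscillation of u over the ball of radius r, divided by r. The quotient converges, so its limit is
bounded by the liminf. -/
theorem enorm_deriv_le_pointwiseLip {u : X → ℝ} {γ : ℝ → X} {s : Set ℝ}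
    (hγ : LipschitzOnWith 1 γ s) (hc : ContinuousOn (u ∘ γ) s) {t : ℝ} (ht : s ∈ 𝓝 t) :
    ‖deriv (u ∘ γ) t‖ₑ ≤ pointwiseLip u (γ t) := by
  by_cases hd : DifferentiableAt ℝ (u ∘ γ) t
  swap
  · simp [deriv_zero_of_not_differentiableAt hd]
  obtain ⟨ε, hε, hεs⟩ := Metric.mem_nhds_iff.1 ht
  have hlim := hd.hasDerivAt.tendsto_slope_zero_right.enorm
  rw [← hlim.liminf_eq]
  refine liminf_le_liminf ?_
  filter_upwards [Ioo_mem_nhdsGT hε] with r hr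
  have hts : t ∈ s := mem_of_mem_nhds ht
  have hmem : ∀ a ∈ Ioc 0 r, t + a ∈ Metric.ball t ε := by
    intro a ha
    rw [Metric.mem_ball, Real.dist_eq, add_sub_cancel_left, abs_of_pos ha.1]
    exact ha.2.trans_lt hr.2
  -- The point γ (t + r) may lie on the sphere and miss the open ball, so the estimate is proved for
  -- steps a < r and passed to the limit.
  have hle : ‖(u ∘ γ) (t + r) - (u ∘ γ) t‖ₑ ≤ ⨆ x' ∈ Metric.ball (γ t) r, edist (u (γ t)) (u x') := by
    have hcr : ContinuousAt (fun a => ‖(u ∘ γ) (t + a) - (u ∘ γ) t‖ₑ) r := by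
      have h1 : ContinuousAt (u ∘ γ) (t + r) :=
        hc.continuousAt (mem_of_superset (Metric.isOpen_ball.mem_nhds
          (hmem r ⟨hr.1, le_rfl⟩)) hεs)
      have h2 : ContinuousAt (fun a => (u ∘ γ) (t + a)) r :=
        ContinuousAt.comp (f := fun a => t + a) h1 (by fun_prop)
      exact (h2.sub continuousAt_const).enorm
    refine le_of_tendsto (hcr.tendsto.mono_left (nhdsWithin_le_nhds (s := Iio r))) ?_
    filter_upwards [Ioo_mem_nhdsLT hr.1] with a ha
    refine le_iSup₂_of_le (γ (t + a)) ?_ ?_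
    · rw [Metric.mem_ball]
      have := hγ.dist_le_mul (t + a) (hεs (hmem a ⟨ha.1, ha.2.le⟩)) t hts
      rw [Real.dist_eq, add_sub_cancel_left, abs_of_pos ha.1] at this
      simp only [NNReal.coe_one, one_mul] at this
      exact this.trans_lt ha.2
    · rw [edist_comm, edist_eq_enorm_sub]
      rfl
  rw [enorm_smul, ENNReal.div_eq_inv_mul, enorm_inv hr.1.ne', Real.enorm_of_nonneg hr.1.le]
  gcongr

variable [MeasurableSpace X] [BorelSpace X]

/-- For a fixed radius the supremum over an open ball is lower semicontinuous where h is continuous,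
and rational radii suffice. No separability of V is used. -/
theorem measurable_indicator_pointwiseLip {U : Set X} (hU : IsOpen U) {h : X → V}
    (hc : ContinuousOn h U) : Measurable (U.indicator (pointwiseLip h)) := by
  set T : ℚ → X → ℝ≥0∞ := fun q => U.indicator fun x =>
    ⨆ x' ∈ Metric.ball x (q : ℝ) ∩ U, edist (h x) (h x') with hT
  have hTm : ∀ q, Measurable (T q) := by
    intro q
    refine LowerSemicontinuous.measurable ?_
    rw [lowerSemicontinuous_iff_isOpen_preimage]
    intro a
    rw [isOpen_iff_mem_nhds]
    intro x hx
    have hxU : x ∈ U := by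
      by_contra hxU
      simp [hT, hxU] at hx
    have hx' : a < ⨆ x' ∈ Metric.ball x (q : ℝ) ∩ U, edist (h x) (h x') := by
      simpa [hT, hxU] using hx
    obtain ⟨x', hx'⟩ := lt_iSup_iff.1 hx'
    obtain ⟨hm, hx'⟩ := lt_iSup_iff.1 hx'
    have hcx : ContinuousAt h x := hc.continuousAt (hU.mem_nhds hxU)
    have h1 : ∀ᶠ y in 𝓝 x, a < edist (h y) (h x') :=
      (hcx.tendsto.edist tendsto_const_nhds).eventually (lt_mem_nhds hx')
    have h2 : ∀ᶠ y in 𝓝 x, x' ∈ Metric.ball y (q : ℝ) := by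
      have : Metric.ball x' (q : ℝ) ∈ 𝓝 x :=
        Metric.isOpen_ball.mem_nhds (Metric.mem_ball_comm.1 hm.1)
      filter_upwards [this] with y hy using Metric.mem_ball_comm.1 hy
    filter_upwards [h1, h2, hU.mem_nhds hxU] with y g1 g2 g3
    simp only [hT, mem_preimage, mem_Ioi, g3, indicator_of_mem]
    exact g1.trans_le (le_iSup₂_of_le x' ⟨g2, hm.2⟩ le_rfl)
  have hG : Measurable fun x => ⨆ (d : ℚ) (_ : 0 < d), ⨅ (q : ℚ) (_ : q ∈ Ioo 0 d),
      T q x / ENNReal.ofReal q :=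
    Measurable.iSup fun d => Measurable.iSup fun _ => Measurable.iInf fun q =>
      Measurable.iInf fun _ => (hTm q).div_const _
  have : U.indicator (pointwiseLip h) = U.indicator fun x => ⨆ (d : ℚ) (_ : 0 < d),
      ⨅ (q : ℚ) (_ : q ∈ Ioo 0 d), T q x / ENNReal.ofReal q := by
    funext x
    by_cases hx : x ∈ U
    · simp only [hx, indicator_of_mem, hT]
      exact pointwiseLip_eq_iSup_iInf_rat hU h hx
    · simp [hx]
  rw [this]
  exact hG.indicator hU.measurableSet

/-- The pointwise Lipschitz constant of a locally Lipschitz function is an upper gradient. -/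
theorem isUpperGradient_pointwiseLip {u : X → ℝ} (hu : LocallyLipschitz u) :
    IsUpperGradient (pointwiseLip u) u := by
  refine ⟨by simpa using measurable_indicator_pointwiseLip isOpen_univ hu.continuous.continuousOn,
    fun ℓ γ hℓ hγ => ?_⟩
  have hγL : LipschitzOnWith 1 γ (Icc 0 ℓ) := by
    intro a ha b hb
    wlog hab : a ≤ b generalizing a b
    · rw [edist_comm, edist_comm a]
      exact this hb ha (le_of_not_ge hab)
    have h1 := hγ ha hb
    have h2 := eVariationOn.edist_le γ (s := Icc 0 ℓ ∩ Icc a b) ⟨ha, le_rfl, hab⟩ ⟨hb, hab, le_rfl⟩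
    rw [h1, edist_comm] at h2
    rw [edist_comm, edist_comm a, edist_dist b, Real.dist_eq, abs_of_nonneg (sub_nonneg.2 hab)]
    rw [edist_comm]
    simpa [edist_comm] using h2
  -- Compactness makes u ∘ γ Lipschitz on the whole interval, hence absolutely continuous, so the
  -- fundamental theorem of calculus applies.
  obtain ⟨K, hK⟩ := LocallyLipschitzOn.exists_lipschitzOnWith_of_compact (f := u ∘ γ)
    (isCompact_Icc (a := 0) (b := ℓ)) (by
      intro t ht
      obtain ⟨K, s, hs, hL⟩ := hu (γ t)
      refine ⟨K * 1, γ ⁻¹' s ∩ Icc 0 ℓ, inter_mem (hγL.continuousOn t ht hs)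
        self_mem_nhdsWithin, ?_⟩
      exact hL.comp (hγL.mono inter_subset_right) fun x hx => hx.1)
  have hac : AbsolutelyContinuousOnInterval (u ∘ γ) 0 ℓ :=
    LipschitzOnWith.absolutelyContinuousOnInterval (by rwa [uIcc_of_le hℓ])
  have hint := hac.integral_deriv_eq_sub
  rw [intervalIntegral.integral_of_le hℓ] at hint
  have h1 : ENNReal.ofReal |u (γ ℓ) - u (γ 0)| = ‖∫ t in Ioc 0 ℓ, deriv (u ∘ γ) t‖ₑ := by
    rw [hint, Real.enorm_eq_ofReal_abs]
    rfl
  rw [h1]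
  refine (enorm_integral_le_lintegral_enorm _).trans ?_
  rw [restrict_Ioc_eq_restrict_Icc, ← restrict_Ioo_eq_restrict_Icc]
  refine setLIntegral_mono' measurableSet_Ioo fun t ht => ?_
  exact enorm_deriv_le_pointwiseLip hγL hK.continuousOn (Icc_mem_nhds ht.1 ht.2)

/-- A maximal ε-separated set is ε-dense, and the balls of radius ε/2 about it are disjoint and of
positive measure, hence countably many. Second countability makes open subsets of X × X measurable
for the product σ-algebra, as Tonelli's theorem requires. -/
theorem secondCountableTopology_of_ball_pos (μ : Measure X) [SFinite μ]
    (hpos : ∀ (x : X) (r : ℝ), 0 < r → 0 < μ (Metric.ball x r)) : SecondCountableTopology X := by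
  refine Metric.secondCountable_of_almost_dense_set fun ε hε => ?_
  obtain ⟨N, hN⟩ := zorn_subset {N : Set X | N.Pairwise fun x y => ε < dist x y} (by
    intro c hc hch
    exact ⟨⋃₀ c, (pairwise_sUnion hch.directedOn).2 fun s hs => hc hs,
      fun s hs => subset_sUnion_of_mem hs⟩)
  refine ⟨N, ?_, fun x => ?_⟩
  · have hd : Pairwise (Function.onFun Disjoint fun i : N => Metric.ball (i : X) (ε / 2)) := by
      intro i j hij
      refine Metric.ball_disjoint_ball ?_
      have := hN.prop i.2 j.2 (fun h => hij (Subtype.ext h))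
      simp only at this
      linarith
    have := Measure.countable_meas_pos_of_disjoint_iUnion (μ := μ)
      (fun i : N => Metric.isOpen_ball.measurableSet) hd
    have huniv : {i : N | 0 < μ (Metric.ball (i : X) (ε / 2))} = univ :=
      eq_univ_of_forall fun i => hpos _ _ (half_pos hε)
    rw [huniv, countable_univ_iff] at this
    exact this
  · by_contra! hx
    have hins : insert x N ∈ {N : Set X | N.Pairwise fun x y => ε < dist x y} := by
      refine hN.prop.insert fun y hy _ => ⟨hx y hy, ?_⟩
      rw [dist_comm]
      exact hx y hy
    have hxN : x ∈ N := hN.le_of_ge hins (subset_insert x N) (mem_insert x N)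
    have := hx x hxN
    simp at this
    linarith

end PointwiseLip

end BVSlices

namespace BVSlices

/-! ### The Poincaré inequality for maps into a Banach space -/

section Averages

variable {X : Type u} [MeasurableSpace X] {μ : Measure X}

theorem enorm_setAverage_sub_le {A : Set X} (h0 : μ A ≠ 0) (ht : μ A ≠ ∞) {u : X → ℝ}
    (hu : IntegrableOn u A μ) (c : ℝ) :
    ‖(⨍ w in A, u w ∂μ) - c‖ₑ ≤ (∫⁻ w in A, ‖u w - c‖ₑ ∂μ) / μ A := by
  have hc : c = ⨍ _ in A, c ∂μ := (setAverage_const h0 ht c).symm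
  have h1 : (⨍ w in A, u w ∂μ) - c = ⨍ w in A, (u w - c) ∂μ := by
    conv_lhs => rw [hc]
    rw [setAverage_eq, setAverage_eq, setAverage_eq, ← smul_sub,
      integral_sub hu (integrableOn_const ht)]
  rw [h1, setAverage_eq, enorm_smul, ENNReal.div_eq_inv_mul]
  gcongr
  · rw [measureReal_def, enorm_inv (by simp [ENNReal.toReal_eq_zero_iff, h0, ht]),
      Real.enorm_of_nonneg ENNReal.toReal_nonneg, ENNReal.ofReal_toReal ht]
  · exact enorm_integral_le_lintegral_enorm _

end Averages

section Potential

variable {X : Type u} [MetricSpace X] [MeasurableSpace X]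

/-- The sum over dyadic radii `s / 2 ^ k` of the mean values of `g` on balls about `x`, dilated by
`lam` and weighted by `2 ^ (-k)`. -/
noncomputable def dyadicPotential (μ : Measure X) (lam : ℝ) (g : X → ℝ≥0∞) (x : X) (s : ℝ) :
    ℝ≥0∞ :=
  ∑' k : ℕ, ENNReal.ofReal (1 / 2 ^ k) *
    ((∫⁻ z in Metric.ball x (lam * (s / 2 ^ k)), g z ∂μ) / μ (Metric.ball x (s / 2 ^ k)))

end Potential

/-- The Poincaré inequality needs real functions on all of X. Taking the minimum of ‖F - v‖ with a
tent θ, equal to M on the ball of radius R and to 0 off the ball of radius 2R, localizes and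
truncates at once: outside the larger ball the minimum vanishes whatever F is there. -/
theorem exists_cutoff {X : Type u} [MetricSpace X] {V : Type*}
    [NormedAddCommGroup V] {U : Set X} (hU : IsOpen U) {F : X → V}
    (hF : LocallyLipschitzOn U F) {x : X} {R : ℝ} (hR : 0 < R)
    (hsub : Metric.closedBall x (2 * R) ⊆ U) (v : V) {M : ℝ} (hM : 0 ≤ M) :
    ∃ u : X → ℝ, LocallyLipschitz u ∧ (∀ y, |u y| ≤ M) ∧
      ∀ y ∈ Metric.ball x R, u y = min ‖F y - v‖ M := by
  set θ : X → ℝ := fun y => max 0 (min M (M * (2 - dist y x / R))) with hθ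
  have hθL : LipschitzWith (Real.toNNReal (M / R)) θ := by
    refine LipschitzWith.const_max (LipschitzWith.const_min (LipschitzWith.of_dist_le_mul
      fun a b => ?_) M) 0
    rw [Real.coe_toNNReal _ (by positivity), Real.dist_eq]
    have : M * (2 - dist a x / R) - M * (2 - dist b x / R)
        = M / R * (dist b x - dist a x) := by ring
    rw [this, abs_mul, abs_of_nonneg (by positivity : 0 ≤ M / R), dist_comm a b]
    gcongr
    exact abs_dist_sub_le b a x
  refine ⟨fun y => min ‖F y - v‖ (θ y), fun y => ?_, fun y => ?_, fun y hy => ?_⟩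
  · by_cases hy : y ∈ U
    · obtain ⟨K, t, ht, hL⟩ := hF hy
      rw [hU.nhdsWithin_eq hy] at ht
      refine ⟨max K (Real.toNNReal (M / R)), t, ht, LipschitzOnWith.of_dist_le_mul
        fun a ha b hb => ?_⟩
      rw [Real.dist_eq]
      refine (abs_min_sub_min_le_max _ _ _ _).trans (max_le ?_ ?_)
      · refine (abs_norm_sub_norm_le _ _).trans ?_
        rw [sub_sub_sub_cancel_right, ← dist_eq_norm]
        refine (hL.dist_le_mul a ha b hb).trans ?_
        gcongr
        exact le_max_left _ _
      · rw [← Real.dist_eq]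
        refine (hθL.dist_le_mul a b).trans ?_
        gcongr
        exact le_max_right _ _
    · refine ⟨0, (Metric.closedBall x (2 * R))ᶜ, Metric.isClosed_closedBall.isOpen_compl.mem_nhds
        fun h => hy (hsub h), ?_⟩
      have h0 : ∀ a ∈ (Metric.closedBall x (2 * R))ᶜ, min ‖F a - v‖ (θ a) = 0 := by
        intro a ha
        have ha' : 2 * R < dist a x := by simpa using ha
        have : 2 - dist a x / R ≤ 0 := by
          rw [sub_nonpos, le_div_iff₀ hR]
          exact ha'.le
        have hθ0 : θ a = 0 := by
          refine max_eq_left ((min_le_right _ _).trans ?_)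
          exact mul_nonpos_of_nonneg_of_nonpos hM this
        rw [hθ0]
        exact min_eq_right (norm_nonneg _)
      intro a ha b hb
      simp only [h0 a ha, h0 b hb, edist_self, zero_le]
  · have h0 : 0 ≤ θ y := le_max_left _ _
    rw [abs_of_nonneg (le_min (norm_nonneg _) h0)]
    exact (min_le_right _ _).trans (max_le hM (min_le_left _ _))
  · have h1 : dist y x / R ≤ 1 := by
      rw [div_le_one hR]
      exact (Metric.mem_ball.1 hy).le
    have : θ y = M := by
      rw [hθ]
      simp only
      rw [min_eq_left (le_mul_of_one_le_right hM (by linarith)), max_eq_right hM]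
    simp only [this]

/-! ### Doubling and telescoping over dyadic balls -/

namespace IsPISpace

variable {X : Type u} [MetricSpace X] [MeasurableSpace X] {μ : Measure X}
  {β τ : ℝ → ℝ≥0} {lam : ℝ}

/-- The bound 2 ^ n * t ≤ 2 keeps every radius that gets doubled at most 1, so only the constant `β
1` enters. -/
theorem measure_ball_two_pow_le (hX : IsPISpace μ β τ lam) (x : X) {t : ℝ} (ht : 0 < t) (n : ℕ)
    (hn : 2 ^ n * t ≤ 2) :
    μ (Metric.ball x (2 ^ n * t)) ≤ (β 1 : ℝ≥0∞) ^ n * μ (Metric.ball x t) := by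
  induction n with
  | zero => simp
  | succ n ih =>
    have h1 : (2 : ℝ) ^ n * t ≤ 1 := by rw [pow_succ] at hn; linarith
    have h2 := hX.doubling 1 (2 ^ n * t) x (by positivity) h1
    have h3 : (2 : ℝ) ^ (n + 1) * t = 2 * (2 ^ n * t) := by ring
    rw [h3]
    calc _ ≤ _ := h2
      _ ≤ β 1 * ((β 1 : ℝ≥0∞) ^ n * μ (Metric.ball x t)) := by gcongr; exact ih (by linarith)
      _ = _ := by ring

theorem measure_ball_le (hX : IsPISpace μ β τ lam) {x z : X} {r t : ℝ} (ht : 0 < t) (n : ℕ)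
    (hn : 2 ^ n * t ≤ 2) (hr : dist z x + r ≤ 2 ^ n * t) :
    μ (Metric.ball z r) ≤ (β 1 : ℝ≥0∞) ^ n * μ (Metric.ball x t) :=
  (measure_mono (Metric.ball_subset_ball' (by linarith))).trans
    (hX.measure_ball_two_pow_le x ht n hn)

theorem measure_ball_ne_zero (hX : IsPISpace μ β τ lam) (x : X) {t : ℝ} (ht : 0 < t) :
    μ (Metric.ball x t) ≠ 0 := (hX.ball_pos x t ht).ne'

theorem measure_ball_ne_top (hX : IsPISpace μ β τ lam) (x : X) (t : ℝ) :
    μ (Metric.ball x t) ≠ ∞ := (hX.ball_lt_top x t).ne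

theorem isLocallyFiniteMeasure (hX : IsPISpace μ β τ lam) : IsLocallyFiniteMeasure μ :=
  ⟨fun x => ⟨Metric.ball x 1, Metric.ball_mem_nhds x one_pos, hX.ball_lt_top x 1⟩⟩

variable [BorelSpace X]

theorem integrableOn_ball (hX : IsPISpace μ β τ lam) {u : X → ℝ} (hu : Continuous u)
    {M : ℝ} (hM : ∀ x, |u x| ≤ M) (x : X) (r : ℝ) : IntegrableOn u (Metric.ball x r) μ :=
  Measure.integrableOn_of_bounded (M := M) (hX.measure_ball_ne_top x r)
    hu.aestronglyMeasurable (Eventually.of_forall hM)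

theorem enorm_setAverage_sub_setAverage_le (hX : IsPISpace μ β τ lam) {u : X → ℝ}
    (hu : Continuous u) {M : ℝ} (hM : ∀ x, |u x| ≤ M) {g : X → ℝ≥0∞} (hg : IsUpperGradient g u)
    {x z : X} {r t : ℝ} (hr : 0 < r) (hr1 : r ≤ 1) (ht : 0 < t)
    (hsub : Metric.ball z t ⊆ Metric.ball x r) :
    ‖(⨍ w in Metric.ball z t, u w ∂μ) - ⨍ w in Metric.ball x r, u w ∂μ‖ₑ ≤
      (ENNReal.ofReal r * τ 1 * ∫⁻ w in Metric.ball x (lam * r), g w ∂μ)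
        / μ (Metric.ball z t) := by
  have := hX.isLocallyFiniteMeasure
  refine (enorm_setAverage_sub_le (hX.measure_ball_ne_zero z ht) (hX.measure_ball_ne_top z t)
    (hX.integrableOn_ball hu hM z t) _).trans ?_
  gcongr
  refine (lintegral_mono_set hsub).trans ?_
  simp only [Real.enorm_eq_ofReal_abs]
  exact hX.poincare 1 r x u g hr hr1 hu.locallyIntegrable hg

theorem tendsto_setAverage_ball (hX : IsPISpace μ β τ lam) {u : X → ℝ}
    (hu : Continuous u) {M : ℝ} (hM : ∀ x, |u x| ≤ M) (x : X) {r : ℕ → ℝ} (hr : ∀ k, 0 < r k)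
    (hr0 : Tendsto r atTop (𝓝 0)) :
    Tendsto (fun k => ⨍ w in Metric.ball x (r k), u w ∂μ) atTop (𝓝 (u x)) := by
  rw [EMetric.tendsto_atTop]
  intro ε hε
  obtain ⟨ε', h0, hε'⟩ := exists_between hε
  have hn : ∀ᶠ y in 𝓝 x, edist (u y) (u x) < ε' :=
    hu.continuousAt.tendsto (Metric.eball_mem_nhds _ h0)
  obtain ⟨d, hd, hb⟩ := Metric.eventually_nhds_iff_ball.1 hn
  obtain ⟨N, hN⟩ := eventually_atTop.1 (hr0.eventually (gt_mem_nhds hd))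
  refine ⟨N, fun k hk => ?_⟩
  rw [edist_eq_enorm_sub]
  refine ((enorm_setAverage_sub_le (hX.measure_ball_ne_zero x (hr k)) (hX.measure_ball_ne_top x _)
    (hX.integrableOn_ball hu hM x _) _).trans ?_).trans_lt hε'
  refine ENNReal.div_le_of_le_mul ?_
  rw [← setLIntegral_const]
  refine setLIntegral_mono' Metric.isOpen_ball.measurableSet fun y hy => ?_
  rw [← edist_eq_enorm_sub]
  exact (hb y (Metric.ball_subset_ball (hN k hk).le hy)).le

/-- Means over the balls of radius s / 2 ^ k converge to u x by continuity. Each consecutive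
difference is controlled by Poincaré on the larger ball, and one doubling replaces the measure of
the half ball; the differences sum to the potential. -/
theorem enorm_setAverage_sub_le_dyadicPotential (hX : IsPISpace μ β τ lam) {u : X → ℝ}
    (hu : Continuous u) {M : ℝ} (hM : ∀ x, |u x| ≤ M) {g : X → ℝ≥0∞} (hg : IsUpperGradient g u)
    (x : X) {s : ℝ} (hs : 0 < s) (hs1 : s ≤ 1) :
    ‖(⨍ w in Metric.ball x s, u w ∂μ) - u x‖ₑ ≤
      β 1 * τ 1 * ENNReal.ofReal s * dyadicPotential μ lam g x s := by
  have hpos : ∀ k : ℕ, 0 < s / 2 ^ k := fun k => by positivity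
  have hle1 : ∀ k : ℕ, s / 2 ^ k ≤ 1 := fun k =>
    (div_le_self hs.le (one_le_pow₀ one_le_two)).trans hs1
  have hlim : Tendsto (fun k : ℕ => s / 2 ^ k) atTop (𝓝 0) := by
    have := (tendsto_pow_atTop_nhds_zero_of_lt_one (r := (1 / 2 : ℝ)) (by norm_num)
      (by norm_num)).const_mul s
    simpa [div_eq_mul_inv] using this
  have key := edist_le_tsum_of_edist_le_of_tendsto₀
    (f := fun k : ℕ => ⨍ w in Metric.ball x (s / 2 ^ k), u w ∂μ)
    (fun k => β 1 * τ 1 * ENNReal.ofReal s * (ENNReal.ofReal (1 / 2 ^ k) *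
    ((∫⁻ z in Metric.ball x (lam * (s / 2 ^ k)), g z ∂μ) / μ (Metric.ball x (s / 2 ^ k)))))
    (fun k => ?_) (hX.tendsto_setAverage_ball hu hM x hpos hlim)
  · rw [ENNReal.tsum_mul_left] at key
    simpa only [dyadicPotential, edist_eq_enorm_sub, pow_zero, div_one] using key
  · rw [edist_comm, edist_eq_enorm_sub]
    refine (hX.enorm_setAverage_sub_setAverage_le hu hM hg (hpos k) (hle1 k) (hpos (k + 1))
      (Metric.ball_subset_ball (by gcongr <;> simp))).trans ?_
    have hd : μ (Metric.ball x (s / 2 ^ k)) ≤ β 1 * μ (Metric.ball x (s / 2 ^ (k + 1))) := by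
      have := hX.doubling 1 (s / 2 ^ (k + 1)) x (hpos _) (hle1 _)
      rwa [show 2 * (s / 2 ^ (k + 1)) = s / 2 ^ k by field_simp; ring] at this
    have h0 := hX.measure_ball_ne_zero x (hpos k)
    have h0' := hX.measure_ball_ne_zero x (hpos (k + 1))
    have ht := hX.measure_ball_ne_top x (s / 2 ^ k)
    have ht' := hX.measure_ball_ne_top x (s / 2 ^ (k + 1))
    set I := ∫⁻ z in Metric.ball x (lam * (s / 2 ^ k)), g z ∂μ
    rw [show s / 2 ^ k = s * (1 / 2 ^ k) by ring] at *
    rw [ENNReal.ofReal_mul hs.le]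
    refine ENNReal.div_le_of_le_mul ?_
    set m := μ (Metric.ball x (s * (1 / 2 ^ k)))
    set m' := μ (Metric.ball x (s / 2 ^ (k + 1)))
    set e := ENNReal.ofReal (1 / 2 ^ k)
    calc ENNReal.ofReal s * e * τ 1 * I = ENNReal.ofReal s * e * τ 1 * (I / m * m) := by
          rw [ENNReal.div_mul_cancel h0 ht]
      _ ≤ ENNReal.ofReal s * e * τ 1 * (I / m * (β 1 * m')) := by gcongr
      _ = _ := by ring

/-- The points x and z are joined through three means: over the ball (x, r), over the large ball (x,
R) containing both small balls, and over the ball (z, t). -/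
theorem enorm_sub_le_of_upperGradient (hX : IsPISpace μ β τ lam) {u : X → ℝ}
    (hu : Continuous u) {M : ℝ} (hM : ∀ x, |u x| ≤ M) {g : X → ℝ≥0∞} (hg : IsUpperGradient g u)
    {x z : X} {r t R : ℝ} (hr : 0 < r) (ht : 0 < t) (hR1 : R ≤ 1) (hrR : r ≤ R)
    (htR : dist z x + t ≤ R) :
    ‖u x - u z‖ₑ ≤ β 1 * τ 1 * ENNReal.ofReal r * dyadicPotential μ lam g x r
      + β 1 * τ 1 * ENNReal.ofReal t * dyadicPotential μ lam g z t
      + (ENNReal.ofReal R * τ 1 * ∫⁻ w in Metric.ball x (lam * R), g w ∂μ) *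
        ((μ (Metric.ball x r))⁻¹ + (μ (Metric.ball z t))⁻¹) := by
  have hR : 0 < R := hr.trans_le hrR
  have htR' : t ≤ R := le_trans (by linarith [dist_nonneg (x := z) (y := x)]) htR
  have h1 := hX.enorm_setAverage_sub_le_dyadicPotential hu hM hg x hr (hrR.trans hR1)
  have h2 := hX.enorm_setAverage_sub_le_dyadicPotential hu hM hg z ht (htR'.trans hR1)
  have h3 := hX.enorm_setAverage_sub_setAverage_le hu hM hg (x := x) (z := x) hR hR1 hr
    (Metric.ball_subset_ball hrR)
  have h4 := hX.enorm_setAverage_sub_setAverage_le hu hM hg (x := x) hR hR1 ht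
    (Metric.ball_subset_ball' (by linarith))
  rw [← edist_eq_enorm_sub] at h1 h2 h3 h4 ⊢
  rw [ENNReal.div_eq_inv_mul] at h3 h4
  set a := ⨍ w in Metric.ball x r, u w ∂μ
  set b := ⨍ w in Metric.ball z t, u w ∂μ
  set c := ⨍ w in Metric.ball x R, u w ∂μ
  calc edist (u x) (u z) ≤ edist a (u x) + (edist a c + edist b c) + edist b (u z) := by
        calc edist (u x) (u z) ≤ edist (u x) a + edist a (u z) := edist_triangle _ _ _
          _ ≤ edist (u x) a + (edist a c + edist c (u z)) := by
            gcongr; exact edist_triangle _ _ _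
          _ ≤ edist (u x) a + (edist a c + (edist c b + edist b (u z))) := by
            gcongr; exact edist_triangle _ _ _
          _ = _ := by rw [edist_comm (u x) a, edist_comm c b]; ring
    _ ≤ _ := add_le_add (add_le_add h1 (add_le_add h3 h4)) h2
    _ = _ := by ring

/-- A pointwise form of the Poincaré inequality, for locally Lipschitz maps into any normed
space. -/
theorem enorm_sub_le_of_locallyLipschitzOn (hX : IsPISpace μ β τ lam)
    {V : Type*} [NormedAddCommGroup V] {U : Set X} (hU : IsOpen U) {F : X → V}
    (hF : LocallyLipschitzOn U F) {x z : X} {r t R : ℝ} (hr : 0 < r) (ht : 0 < t) (hR1 : R ≤ 1)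
    (hrR : r ≤ R) (htR : dist z x + t ≤ R) (hsub : Metric.closedBall x (2 * (lam * R)) ⊆ U) :
    ‖F x - F z‖ₑ ≤ β 1 * τ 1 * ENNReal.ofReal r * dyadicPotential μ lam (pointwiseLip F) x r
      + β 1 * τ 1 * ENNReal.ofReal t * dyadicPotential μ lam (pointwiseLip F) z t
      + (ENNReal.ofReal R * τ 1 * ∫⁻ w in Metric.ball x (lam * R), pointwiseLip F w ∂μ) *
        ((μ (Metric.ball x r))⁻¹ + (μ (Metric.ball z t))⁻¹) := by
  have hR : 0 < R := hr.trans_le hrR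
  have hlam := hX.one_le_dilation
  have hRl : R ≤ lam * R := le_mul_of_one_le_left hR.le hlam
  -- With centre F z and truncation level ‖F x - F z‖, u vanishes at z and attains that level at x,
  -- so the scalar increment carries the whole norm. The radius `lam * R` covers all dilated balls
  -- in the estimate, and there Lip u ≤ Lip F.
  obtain ⟨u, huL, huM, hu⟩ := exists_cutoff hU hF (by positivity : 0 < lam * R) hsub (F z)
    (norm_nonneg (F x - F z))
  have hux : u x = ‖F x - F z‖ := by
    rw [hu x (Metric.mem_ball_self (by positivity)), min_self]
  have hzb : z ∈ Metric.ball x (lam * R) := by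
    rw [Metric.mem_ball]
    linarith
  have huz : u z = 0 := by
    rw [hu z hzb]
    simp
  have hlip : ∀ y ∈ Metric.ball x (lam * R), pointwiseLip u y ≤ pointwiseLip F y := by
    intro y hy
    refine pointwiseLip_mono ?_
    filter_upwards [Metric.isOpen_ball.mem_nhds hy] with y' hy'
    rw [hu y hy, hu y' hy', edist_dist, edist_dist]
    refine ENNReal.ofReal_le_ofReal ?_
    rw [Real.dist_eq]
    refine (abs_min_sub_min_le_max _ _ _ _).trans (max_le ?_ (by simp))
    refine (abs_norm_sub_norm_le _ _).trans ?_
    rw [sub_sub_sub_cancel_right, ← dist_eq_norm]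
  have hint : ∀ y s, Metric.ball y s ⊆ Metric.ball x (lam * R) →
      ∫⁻ w in Metric.ball y s, pointwiseLip u w ∂μ ≤
        ∫⁻ w in Metric.ball y s, pointwiseLip F w ∂μ := fun y s hs =>
    setLIntegral_mono' Metric.isOpen_ball.measurableSet fun w hw => hlip w (hs hw)
  have hpot : ∀ y s, 0 < s → dist y x + s ≤ R →
      dyadicPotential μ lam (pointwiseLip u) y s ≤ dyadicPotential μ lam (pointwiseLip F) y s := by
    intro y s hs hys
    refine ENNReal.tsum_le_tsum fun k => ?_
    refine mul_le_mul_right (ENNReal.div_le_div_right ?_ _) _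
    refine hint _ _ (Metric.ball_subset_ball' ?_)
    have h1 : s / 2 ^ k ≤ s := div_le_self hs.le (one_le_pow₀ one_le_two)
    have h2 : dist y x ≤ lam * dist y x := le_mul_of_one_le_left dist_nonneg hlam
    have h3 : lam * (s / 2 ^ k) ≤ lam * s := by gcongr
    have h4 : lam * (dist y x + s) ≤ lam * R := by gcongr
    linarith
  have key := hX.enorm_sub_le_of_upperGradient huL.continuous huM
    (isUpperGradient_pointwiseLip huL) hr ht hR1 hrR htR
  rw [hux, huz, sub_zero, enorm_norm] at key
  have h1 := hpot x r hr (by simpa using hrR)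
  have h2 := hpot z t ht htR
  have h3 := hint x (lam * R) subset_rfl
  exact key.trans (by gcongr _ * _ * _ * ?_ + _ * _ * _ * ?_ + _ * _ * ?_ * _)

end IsPISpace

end BVSlices

namespace BVSlices

/-! ### Whitney-type scales and the nonlocal energy -/

section Scale

variable {X : Type u} [MetricSpace X]

/-- A slowly varying family of radii `s x`, small compared with the distance to the complement
of `U` and with `δ`. -/
structure IsScale (U : Set X) (lam δ : ℝ) (s : X → ℝ) : Prop where
  pos : ∀ x ∈ U, 0 < s x
  abs_sub_le : ∀ x y, 128 * lam * |s x - s y| ≤ dist x y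
  closedBall_subset : ∀ x ∈ U, Metric.closedBall x (64 * lam * s x) ⊆ U
  le : ∀ x, 128 * lam * s x ≤ δ

theorem exists_isScale {U : Set X} (hU : IsOpen U) {lam δ : ℝ} (hlam : 0 < lam) (hδ : 0 < δ) :
    ∃ s : X → ℝ, IsScale U lam δ s := by
  -- The extended distance is used because it is ∞ when U = X; the minimum with δ makes it finite.
  set d : X → ℝ≥0∞ := fun x => min (ENNReal.ofReal δ) (Metric.infEDist x Uᶜ) with hd
  have hdt : ∀ x, d x ≠ ∞ := fun x => ne_top_of_le_ne_top ENNReal.ofReal_ne_top (min_le_left _ _)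
  have hdL : ∀ x y, (d x).toReal ≤ (d y).toReal + dist x y := by
    intro x y
    rw [← ENNReal.toReal_ofReal (dist_nonneg (x := x) (y := y)), ← edist_dist,
      ← ENNReal.toReal_add (hdt y) (edist_ne_top _ _)]
    refine ENNReal.toReal_mono (by finiteness [hdt y]) ?_
    simp only [hd]
    rw [min_add]
    exact min_le_min le_self_add Metric.infEDist_le_infEDist_add_edist
  refine ⟨fun x => (d x).toReal / (128 * lam), fun x hx => ?_, fun x y => ?_, fun x hx => ?_,
    fun x => ?_⟩
  · refine div_pos (ENNReal.toReal_pos (ne_of_gt (lt_min (by simpa using hδ) ?_)) (hdt x))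
      (by positivity)
    rw [pos_iff_ne_zero]
    intro h0
    rw [← Metric.mem_closure_iff_infEDist_zero, hU.isClosed_compl.closure_eq] at h0
    exact h0 hx
  · rw [← sub_div, abs_div, abs_of_pos (by positivity : 0 < 128 * lam),
      mul_div_cancel₀ _ (by positivity), abs_sub_le_iff]
    have h1 := hdL x y
    have h2 := hdL y x
    rw [dist_comm] at h2
    constructor <;> linarith
  · intro y hy
    by_contra hyU
    have h1 : Metric.infEDist x Uᶜ ≤ edist x y := Metric.infEDist_le_edist_of_mem hyU
    have h2 : (d x).toReal ≤ dist x y := by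
      rw [← ENNReal.toReal_ofReal (dist_nonneg (x := x) (y := y)), ← edist_dist]
      exact ENNReal.toReal_mono (edist_ne_top _ _) ((min_le_right _ _).trans h1)
    have h3 : dist y x ≤ (d x).toReal / 2 := by
      refine (Metric.mem_closedBall.1 hy).trans (le_of_eq ?_)
      field_simp
      ring
    have h4 : 0 < (d x).toReal := by
      refine ENNReal.toReal_pos (ne_of_gt (lt_min (by simpa using hδ) ?_)) (hdt x)
      rw [pos_iff_ne_zero]
      intro h0
      rw [← Metric.mem_closure_iff_infEDist_zero, hU.isClosed_compl.closure_eq] at h0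
      exact h0 hx
    rw [dist_comm] at h3
    linarith
  · rw [mul_div_cancel₀ _ (by positivity)]
    calc (d x).toReal ≤ (ENNReal.ofReal δ).toReal :=
          ENNReal.toReal_mono ENNReal.ofReal_ne_top (min_le_left _ _)
      _ = δ := ENNReal.toReal_ofReal hδ.le

namespace IsScale

variable {U : Set X} {lam δ : ℝ} {s : X → ℝ}

theorem continuous (hs : IsScale U lam δ s) (hlam : 1 ≤ lam) : Continuous s := by
  refine LipschitzWith.continuous (K := 1) (LipschitzWith.of_dist_le_mul fun x y => ?_)
  have h1 := hs.abs_sub_le x y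
  rw [Real.dist_eq, NNReal.coe_one, one_mul]
  have h2 : 1 * |s x - s y| ≤ 128 * lam * |s x - s y| := by gcongr; linarith
  linarith

/-- The Lipschitz constant 1 / (128 λ) lets s change by at most s x / 2 within distance 64 λ s x.
This is what allows the roles of centre and variable to be exchanged in the averages. -/
theorem le_two_mul (hs : IsScale U lam δ s) (hlam : 1 ≤ lam) {x z : X}
    (h : dist z x ≤ 64 * lam * s x) : s x ≤ 2 * s z ∧ s z ≤ 2 * s x := by
  have h1 : |s z - s x| ≤ s x / 2 := by
    have h2 := (hs.abs_sub_le z x).trans h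
    have h3 : 0 < 64 * lam := by linarith
    have h4 : 64 * lam * (2 * |s z - s x|) ≤ 64 * lam * s x := by linarith
    have := le_of_mul_le_mul_left h4 h3
    linarith
  rw [abs_le] at h1
  have : 0 ≤ s x := by linarith
  constructor <;> linarith

end IsScale

end Scale

/-! ### Averages and kernels at a variable scale -/

section Averaging

variable {X : Type u} [MetricSpace X] [MeasurableSpace X]

/-- The integral of `g` over the ball of radius `b * s x`, divided by the measure of the ball of
radius `a * s x`. -/
noncomputable def scaleAverage (μ : Measure X) (s : X → ℝ) (a b : ℝ) (g : X → ℝ≥0∞) (x : X) :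
    ℝ≥0∞ :=
  (μ (Metric.ball x (a * s x)))⁻¹ * ∫⁻ z in Metric.ball x (b * s x), g z ∂μ

/-- The kernel of the nonlocal energy at the scale `s`. -/
noncomputable def scaleKernel (μ : Measure X) (s : X → ℝ) (x z : X) : ℝ≥0∞ :=
  (Metric.ball x (s x)).indicator
    (fun _ => (ENNReal.ofReal (s x) * μ (Metric.ball x (s x)))⁻¹) z

/-- The nonlocal energy with kernel `k`. -/
noncomputable def kernelEnergy {V : Type*} [NormedAddCommGroup V] (m : Measure X)
    (k : X → X → ℝ≥0∞) (h : X → V) : ℝ≥0∞ :=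
  ∫⁻ x, ∫⁻ z, k x z * ‖h z - h x‖ₑ ∂m ∂m

/-- This form reduces measurability and L¹ bounds of the potential to those of single averages. -/
theorem dyadicPotential_eq_tsum_scaleAverage (μ : Measure X) (lam : ℝ) (s : X → ℝ) (g : X → ℝ≥0∞) (x : X) :
    dyadicPotential μ lam g x (s x) = ∑' k : ℕ, ENNReal.ofReal (1 / 2 ^ k) *
      scaleAverage μ s (1 / 2 ^ k) (lam / 2 ^ k) g x := by
  simp only [dyadicPotential, scaleAverage, ENNReal.div_eq_inv_mul]
  refine tsum_congr fun k => ?_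
  rw [show lam * (s x / 2 ^ k) = lam / 2 ^ k * s x by ring,
    show s x / 2 ^ k = 1 / 2 ^ k * s x by ring]

variable [BorelSpace X] [SecondCountableTopology X] {μ : Measure X} [SFinite μ]

theorem measurableSet_dist_lt {s : X → ℝ} (hs : Continuous s) :
    MeasurableSet {p : X × X | p.2 ∈ Metric.ball p.1 (s p.1)} :=
  (isOpen_lt (continuous_snd.dist continuous_fst) (hs.comp continuous_fst)).measurableSet

theorem measurable_setLIntegral_ball {s : X → ℝ} (hs : Continuous s) {g : X → ℝ≥0∞}
    (hg : Measurable g) : Measurable fun x => ∫⁻ z in Metric.ball x (s x), g z ∂μ := by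
  have h1 : Measurable fun p : X × X =>
      {p : X × X | p.2 ∈ Metric.ball p.1 (s p.1)}.indicator (fun p => g p.2) p :=
    (hg.comp measurable_snd).indicator (measurableSet_dist_lt hs)
  have h2 := h1.lintegral_prod_right' (ν := μ)
  convert h2 using 2 with x
  rw [← lintegral_indicator Metric.isOpen_ball.measurableSet]
  rfl

theorem measurable_measure_ball {s : X → ℝ} (hs : Continuous s) :
    Measurable fun x => μ (Metric.ball x (s x)) := by
  simpa using measurable_setLIntegral_ball (μ := μ) hs (measurable_const (a := (1 : ℝ≥0∞)))

theorem measurable_scaleAverage {s : X → ℝ} (hs : Continuous s) (a b : ℝ) {g : X → ℝ≥0∞}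
    (hg : Measurable g) : Measurable (scaleAverage μ s a b g) :=
  (measurable_measure_ball (hs.const_mul a)).inv.mul (measurable_setLIntegral_ball
    (hs.const_mul b) hg)

theorem measurable_scaleKernel {s : X → ℝ} (hs : Continuous s) :
    Measurable fun p : X × X => scaleKernel μ s p.1 p.2 := by
  have h1 : Measurable fun p : X × X => {p : X × X | p.2 ∈ Metric.ball p.1 (s p.1)}.indicator
      (fun p => (ENNReal.ofReal (s p.1) * μ (Metric.ball p.1 (s p.1)))⁻¹) p := by
    refine Measurable.indicator ?_ (measurableSet_dist_lt hs)
    have h2 : Measurable fun x => (ENNReal.ofReal (s x) * μ (Metric.ball x (s x)))⁻¹ :=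
      ((ENNReal.measurable_ofReal.comp hs.measurable).mul (measurable_measure_ball hs)).inv
    exact h2.comp measurable_fst
  exact h1

end Averaging

/-! ### L¹ bounds for averages and the energy of locally Lipschitz maps -/

namespace IsPISpace

variable {X : Type u} [MetricSpace X] [MeasurableSpace X] {μ : Measure X}
  {β τ : ℝ → ℝ≥0} {lam : ℝ} {U : Set X} {δ : ℝ} {s : X → ℝ}

theorem inv_measure_ball_le (hX : IsPISpace μ β τ lam) {x z : X} {r t : ℝ} (ht : 0 < t) (hr : 0 < r)
    (n : ℕ) (hn : 2 ^ n * t ≤ 2) (hd : dist z x + r ≤ 2 ^ n * t) :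
    (μ (Metric.ball x t))⁻¹ ≤ (β 1 : ℝ≥0∞) ^ n * (μ (Metric.ball z r))⁻¹ := by
  rw [ENNReal.inv_le_iff_inv_le, ENNReal.mul_inv (Or.inr (ENNReal.inv_ne_top.2
    (hX.measure_ball_ne_zero z hr))) (Or.inl (by finiteness)), inv_inv]
  rw [mul_comm, ← ENNReal.div_eq_inv_mul.trans (mul_comm _ _)]
  refine ENNReal.div_le_of_le_mul ?_
  rw [mul_comm]
  exact hX.measure_ball_le ht n hn hd

variable [BorelSpace X]

theorem lintegral_scaleKernel_mul (hX : IsPISpace μ β τ lam)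
    (hs : IsScale U lam δ s) {x : X} (hx : x ∈ U) (f : X → ℝ≥0∞) :
    ∫⁻ z, scaleKernel μ s x z * f z ∂(μ.restrict U) =
      (ENNReal.ofReal (s x))⁻¹ * ((μ (Metric.ball x (s x)))⁻¹ *
        ∫⁻ z in Metric.ball x (s x), f z ∂μ) := by
  have hsx := hs.pos x hx
  have hlam := hX.one_le_dilation
  have hsub : Metric.ball x (s x) ⊆ U := (Metric.ball_subset_closedBall.trans
    (Metric.closedBall_subset_closedBall (le_mul_of_one_le_left hsx.le (by linarith)))).trans
    (hs.closedBall_subset x hx)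
  have h1 : ∀ z, scaleKernel μ s x z * f z = (Metric.ball x (s x)).indicator
      (fun z => (ENNReal.ofReal (s x) * μ (Metric.ball x (s x)))⁻¹ * f z) z := by
    intro z
    by_cases hz : z ∈ Metric.ball x (s x)
    · simp only [scaleKernel, indicator_of_mem hz]
    · simp only [scaleKernel, indicator_of_notMem hz, zero_mul]
  have h0 : ENNReal.ofReal (s x) ≠ 0 := by simpa using hsx
  simp only [h1]
  rw [lintegral_indicator Metric.isOpen_ball.measurableSet,
    Measure.restrict_restrict Metric.isOpen_ball.measurableSet, inter_eq_left.2 hsub,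
    lintegral_const_mul', ENNReal.mul_inv (Or.inl h0) (Or.inl ENNReal.ofReal_ne_top), mul_assoc]
  refine ENNReal.inv_ne_top.2 (mul_ne_zero h0 (hX.measure_ball_ne_zero x hsx))

variable [SecondCountableTopology X] [SFinite μ]

/-- The averaging operators at the scale `s` are bounded on `L¹(U)`. -/
theorem lintegral_scaleAverage_le (hX : IsPISpace μ β τ lam) (hU : IsOpen U) (hδ1 : δ ≤ 1)
    (hs : IsScale U lam δ s) {a b : ℝ} (ha : 0 < a) (hb : 0 < b) {N : ℕ} (hab : 8 * b ≤ 2 ^ N * a)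
    (hN : 2 ^ N * a ≤ 128 * lam) (hbl : b ≤ 64 * lam) {g : X → ℝ≥0∞} (hg : Measurable g) :
    ∫⁻ x in U, scaleAverage μ s a b g x ∂μ ≤ (β 1 : ℝ≥0∞) ^ N * ∫⁻ x in U, g x ∂μ := by
  have hlam := hX.one_le_dilation
  have hsc := hs.continuous hlam
  set S : Set (X × X) := {p : X × X | p.2 ∈ Metric.ball p.1 (b * s p.1)} with hS
  have hSm : MeasurableSet S := measurableSet_dist_lt (hsc.const_mul b)
  set G : X → X → ℝ≥0∞ := fun x z =>
    S.indicator (fun p => (μ (Metric.ball p.1 (a * s p.1)))⁻¹ * g p.2) (x, z) with hG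
  have hGm : Measurable (Function.uncurry G) := by
    have h2 : Measurable fun x => (μ (Metric.ball x (a * s x)))⁻¹ :=
      (measurable_measure_ball (hsc.const_mul a)).inv
    exact ((h2.comp measurable_fst).mul (hg.comp measurable_snd)).indicator hSm
  have h1 : ∫⁻ x in U, scaleAverage μ s a b g x ∂μ = ∫⁻ x in U, ∫⁻ z in U, G x z ∂μ ∂μ := by
    refine setLIntegral_congr_fun hU.measurableSet fun x hx => ?_
    have hsx := hs.pos x hx
    have hsub : Metric.ball x (b * s x) ⊆ U := (Metric.ball_subset_closedBall.trans
      (Metric.closedBall_subset_closedBall (by gcongr))).trans (hs.closedBall_subset x hx)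
    have h2 : ∀ z, G x z = (Metric.ball x (b * s x)).indicator
        (fun z => (μ (Metric.ball x (a * s x)))⁻¹ * g z) z := fun z => rfl
    simp only [h2]
    rw [lintegral_indicator Metric.isOpen_ball.measurableSet,
      Measure.restrict_restrict Metric.isOpen_ball.measurableSet, inter_eq_left.2 hsub,
      lintegral_const_mul _ hg]
    rfl
  rw [h1, lintegral_lintegral_swap hGm.aemeasurable, ← lintegral_const_mul _ hg]
  refine setLIntegral_mono' hU.measurableSet fun z hz => ?_
  have hsz := hs.pos z hz
  -- After Tonelli z is fixed. Every x contributing lies in the ball of radius 2 b s z about z, and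
  -- N doublings compare the normalizing balls: dist z x + 2 b s z ≤ 5 b s x, which `hab` absorbs.
  -- The integral over x then cancels the measure.
  have hpt : ∀ x ∈ U, G x z ≤ (Metric.ball z (2 * b * s z)).indicator (fun _ =>
      (β 1 : ℝ≥0∞) ^ N * (μ (Metric.ball z (2 * b * s z)))⁻¹ * g z) x := by
    intro x hx
    have hsx := hs.pos x hx
    by_cases hxz : (x, z) ∈ S
    · have hd : dist z x < b * s x := hxz
      have hd' : dist z x ≤ 64 * lam * s x := hd.le.trans (by gcongr)
      obtain ⟨h3, h4⟩ := hs.le_two_mul hlam hd'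
      have hmem : x ∈ Metric.ball z (2 * b * s z) := by
        rw [Metric.mem_ball, dist_comm]
        calc dist z x < b * s x := hd
          _ ≤ b * (2 * s z) := by gcongr
          _ = _ := by ring
      rw [indicator_of_mem hmem]
      simp only [hG, indicator_of_mem hxz]
      gcongr
      refine hX.inv_measure_ball_le (by positivity) (by positivity) N ?_ ?_
      · calc 2 ^ N * (a * s x) = 2 ^ N * a * s x := by ring
          _ ≤ 128 * lam * s x := by gcongr
          _ ≤ 2 := by linarith [hs.le x]
      · calc dist z x + 2 * b * s z ≤ b * s x + 2 * b * (2 * s x) := by gcongr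
          _ = 5 * b * s x := by ring
          _ ≤ 8 * b * s x := by gcongr; norm_num
          _ ≤ 2 ^ N * a * s x := by gcongr
          _ = _ := by ring
    · simp only [hG, indicator_of_notMem hxz, zero_le]
  refine (setLIntegral_mono' hU.measurableSet hpt).trans ?_
  rw [lintegral_indicator Metric.isOpen_ball.measurableSet,
    Measure.restrict_restrict Metric.isOpen_ball.measurableSet, setLIntegral_const]
  have hB0 := hX.measure_ball_ne_zero z (by positivity : 0 < 2 * b * s z)
  have hBt := hX.measure_ball_ne_top z (2 * b * s z)
  calc _ ≤ (β 1 : ℝ≥0∞) ^ N * (μ (Metric.ball z (2 * b * s z)))⁻¹ * g z *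
        μ (Metric.ball z (2 * b * s z)) := by gcongr; exact inter_subset_left
    _ = (β 1 : ℝ≥0∞) ^ N * g z * ((μ (Metric.ball z (2 * b * s z)))⁻¹ *
        μ (Metric.ball z (2 * b * s z))) := by ring
    _ = _ := by rw [ENNReal.inv_mul_cancel hB0 hBt, mul_one]

theorem measurable_dyadicPotential (hX : IsPISpace μ β τ lam) (hs : IsScale U lam δ s)
    {g : X → ℝ≥0∞} (hg : Measurable g) :
    Measurable fun x => dyadicPotential μ lam g x (s x) := by
  simp only [dyadicPotential_eq_tsum_scaleAverage]
  exact Measurable.tsum fun k =>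
    (measurable_scaleAverage (hs.continuous hX.one_le_dilation) _ _ hg).const_mul _

/-- The ratio of the two radii in each average is λ for every k, so one N serves all terms; the
weights 2 ^ (-k) sum to 2. -/
theorem lintegral_dyadicPotential_le (hX : IsPISpace μ β τ lam) (hU : IsOpen U) (hδ1 : δ ≤ 1)
    (hs : IsScale U lam δ s) {N : ℕ} (hN1 : 8 * lam ≤ 2 ^ N) (hN2 : 2 ^ N ≤ 16 * lam)
    {g : X → ℝ≥0∞} (hg : Measurable g) :
    ∫⁻ x in U, dyadicPotential μ lam g x (s x) ∂μ ≤
      2 * (β 1 : ℝ≥0∞) ^ N * ∫⁻ x in U, g x ∂μ := by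
  have hlam := hX.one_le_dilation
  have hsc := hs.continuous hlam
  simp only [dyadicPotential_eq_tsum_scaleAverage]
  rw [lintegral_tsum fun k => ((measurable_scaleAverage hsc _ _ hg).const_mul _).aemeasurable]
  have h1 : ∀ k : ℕ, ∫⁻ x in U, ENNReal.ofReal (1 / 2 ^ k) *
      scaleAverage μ s (1 / 2 ^ k) (lam / 2 ^ k) g x ∂μ ≤
      (2⁻¹ : ℝ≥0∞) ^ k * ((β 1 : ℝ≥0∞) ^ N * ∫⁻ x in U, g x ∂μ) := by
    intro k
    rw [lintegral_const_mul _ (measurable_scaleAverage hsc _ _ hg)]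
    have h2 : (1 : ℝ) ≤ 2 ^ k := one_le_pow₀ one_le_two
    have h3 : ENNReal.ofReal (1 / 2 ^ k) = (2⁻¹ : ℝ≥0∞) ^ k := by
      rw [one_div, ← inv_pow, ENNReal.ofReal_pow (by norm_num), ENNReal.ofReal_inv_of_pos two_pos]
      simp
    rw [h3]
    gcongr
    refine hX.lintegral_scaleAverage_le hU hδ1 hs (by positivity) (by positivity) ?_ ?_ ?_ hg
    · calc 8 * (lam / 2 ^ k) = 8 * lam * (1 / 2 ^ k) := by ring
        _ ≤ _ := by gcongr
    · rw [mul_one_div]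
      exact (div_le_self (by positivity) h2).trans (by linarith)
    · exact (div_le_self (by positivity) h2).trans (by linarith)
  refine (ENNReal.tsum_le_tsum h1).trans ?_
  rw [ENNReal.tsum_mul_right, ENNReal.tsum_geometric, ENNReal.one_sub_inv_two, inv_inv, mul_assoc]

/-- The nonlocal energy of a locally Lipschitz map is controlled by the integral of its pointwise
Lipschitz constant. -/
theorem kernelEnergy_le_of_locallyLipschitzOn (hX : IsPISpace μ β τ lam)
    {V : Type*} [NormedAddCommGroup V] (hU : IsOpen U) (hδ1 : δ ≤ 1)
    (hs : IsScale U lam δ s) {N : ℕ} (hN1 : 8 * lam ≤ 2 ^ N) (hN2 : 2 ^ N ≤ 16 * lam)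
    {F : X → V} (hF : LocallyLipschitzOn U F) :
    kernelEnergy (μ.restrict U) (scaleKernel μ s) F ≤
      (β 1 * τ 1 * (2 * β 1 ^ N) + 2 * (β 1 * τ 1) * (β 1 ^ 3 * (2 * β 1 ^ N)) +
        4 * τ 1 * (1 + β 1 ^ 2) * β 1 ^ (N + 2) : ℝ≥0∞) * ∫⁻ x in U, pointwiseLip F x ∂μ := by
  have hlam := hX.one_le_dilation
  have hsc := hs.continuous hlam
  -- Lip F is known to be Borel only after cutting off outside U; all balls involved lie in U, so
  -- the integrals agree.
  set g : X → ℝ≥0∞ := U.indicator (pointwiseLip F) with hg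
  have hgm : Measurable g := measurable_indicator_pointwiseLip hU hF.continuousOn
  set P : X → ℝ≥0∞ := fun x => dyadicPotential μ lam g x (s x) with hP
  have hPm : Measurable P := hX.measurable_dyadicPotential hs hgm
  set A : X → ℝ≥0∞ := scaleAverage μ s 1 (4 * lam) g with hA
  have hAm : Measurable A := measurable_scaleAverage hsc _ _ hgm
  have hI : ∫⁻ x in U, g x ∂μ = ∫⁻ x in U, pointwiseLip F x ∂μ :=
    setLIntegral_congr_fun hU.measurableSet fun x hx => by simp [hg, hx]
  have hgball : ∀ x r, Metric.ball x r ⊆ U →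
      ∫⁻ w in Metric.ball x r, pointwiseLip F w ∂μ = ∫⁻ w in Metric.ball x r, g w ∂μ :=
    fun x r hsub => setLIntegral_congr_fun Metric.isOpen_ball.measurableSet fun w hw => by
      simp [hg, hsub hw]
  have hballU : ∀ x ∈ U, ∀ c ≤ 64 * lam, Metric.ball x (c * s x) ⊆ U := fun x hx c hc =>
    (Metric.ball_subset_closedBall.trans (Metric.closedBall_subset_closedBall
      (by gcongr; exact (hs.pos x hx).le))).trans (hs.closedBall_subset x hx)
  have hPF : ∀ x ∈ U, dyadicPotential μ lam (pointwiseLip F) x (s x) = P x := by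
    intro x hx
    refine tsum_congr fun k => ?_
    rw [hgball]
    have := hballU x hx (lam / 2 ^ k) ((div_le_self (by positivity)
      (one_le_pow₀ one_le_two)).trans (by linarith))
    rwa [show lam * (s x / 2 ^ k) = lam / 2 ^ k * s x by ring]
  have hpt : ∀ x ∈ U, ∀ z ∈ Metric.ball x (s x), ‖F z - F x‖ₑ ≤ ENNReal.ofReal (s x) *
      ((β 1 * τ 1 * P x + 4 * τ 1 * (1 + β 1 ^ 2) * A x) + 2 * (β 1 * τ 1) * P z) := by
    intro x hx z hz
    have hsx := hs.pos x hx
    have hsx1 : 128 * s x ≤ 1 := by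
      have h1 : 128 * 1 * s x ≤ 128 * lam * s x := by gcongr
      linarith [hs.le x]
    have hd : dist z x < s x := hz
    have hzU : z ∈ U := hballU x hx 1 (by linarith) (by simpa using hz)
    have hsz := hs.pos z hzU
    obtain ⟨h3, h4⟩ := hs.le_two_mul hlam (x := x) (z := z)
      (hd.le.trans (le_mul_of_one_le_left hsx.le (by linarith)))
    -- Since s z ≤ 2 s x, one has dist z x + s z ≤ 3 s x, so the common radius 4 s x is large
    -- enough.
    have key := hX.enorm_sub_le_of_locallyLipschitzOn hU hF (x := x) (z := z) (r := s x) (t := s z)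
      (R := 4 * s x) hsx hsz (by linarith) (by linarith) (by linarith)
      ((Metric.closedBall_subset_closedBall (by
        have : 0 ≤ lam * s x := by positivity
        linarith)).trans (hs.closedBall_subset x hx))
    rw [hPF x hx, hPF z hzU, hgball x _ (by
      rw [show lam * (4 * s x) = 4 * lam * s x by ring]
      exact hballU x hx _ (by linarith))] at key
    rw [← edist_eq_enorm_sub, edist_comm, edist_eq_enorm_sub]
    have hinv : (μ (Metric.ball z (s z)))⁻¹ ≤ (β 1 : ℝ≥0∞) ^ 2 * (μ (Metric.ball x (s x)))⁻¹ := by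
      refine hX.inv_measure_ball_le hsz hsx 2 (by linarith) ?_
      rw [dist_comm]
      linarith
    have hz2 : ENNReal.ofReal (s z) ≤ 2 * ENNReal.ofReal (s x) := by
      rw [← ENNReal.ofReal_ofNat 2, ← ENNReal.ofReal_mul (by norm_num)]
      exact ENNReal.ofReal_le_ofReal h4
    have hA' : A x = (μ (Metric.ball x (s x)))⁻¹ *
        ∫⁻ w in Metric.ball x (lam * (4 * s x)), g w ∂μ := by
      simp only [hA, scaleAverage, one_mul]
      rw [show 4 * lam * s x = lam * (4 * s x) by ring]
    rw [ENNReal.ofReal_mul (by norm_num), ENNReal.ofReal_ofNat] at key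
    set J := ∫⁻ w in Metric.ball x (lam * (4 * s x)), g w ∂μ
    refine key.trans ?_
    calc β 1 * τ 1 * ENNReal.ofReal (s x) * P x + β 1 * τ 1 * ENNReal.ofReal (s z) * P z +
          4 * ENNReal.ofReal (s x) * τ 1 * J *
            ((μ (Metric.ball x (s x)))⁻¹ + (μ (Metric.ball z (s z)))⁻¹)
        ≤ β 1 * τ 1 * ENNReal.ofReal (s x) * P x
          + β 1 * τ 1 * (2 * ENNReal.ofReal (s x)) * P z +
          4 * ENNReal.ofReal (s x) * τ 1 * J *
            ((μ (Metric.ball x (s x)))⁻¹ + (β 1 : ℝ≥0∞) ^ 2 * (μ (Metric.ball x (s x)))⁻¹) := by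
          gcongr
      _ = _ := by rw [hA']; ring
  have hpt2 : ∀ x ∈ U, ∫⁻ z, scaleKernel μ s x z * ‖F z - F x‖ₑ ∂(μ.restrict U) ≤
      (β 1 * τ 1 * P x + 4 * τ 1 * (1 + β 1 ^ 2) * A x) +
        2 * (β 1 * τ 1) * scaleAverage μ s 1 1 P x := by
    intro x hx
    have hsx := hs.pos x hx
    rw [hX.lintegral_scaleKernel_mul hs hx]
    set D : ℝ≥0∞ := β 1 * τ 1 * P x + 4 * τ 1 * (1 + β 1 ^ 2) * A x
    have h0 : ENNReal.ofReal (s x) ≠ 0 := by simpa using hsx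
    have hB0 := hX.measure_ball_ne_zero x hsx
    have hBt := hX.measure_ball_ne_top x (s x)
    calc _ ≤ (ENNReal.ofReal (s x))⁻¹ * ((μ (Metric.ball x (s x)))⁻¹ *
          ∫⁻ z in Metric.ball x (s x), ENNReal.ofReal (s x) *
            (D + 2 * (β 1 * τ 1) * P z) ∂μ) := by
          gcongr _ * (_ * ?_)
          exact setLIntegral_mono' Metric.isOpen_ball.measurableSet (hpt x hx)
      _ = (ENNReal.ofReal (s x))⁻¹ * ENNReal.ofReal (s x) *
          (D * ((μ (Metric.ball x (s x)))⁻¹ * μ (Metric.ball x (s x))) +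
          2 * (β 1 * τ 1) * ((μ (Metric.ball x (s x)))⁻¹ *
            ∫⁻ z in Metric.ball x (s x), P z ∂μ)) := by
          rw [lintegral_const_mul _ (by fun_prop), lintegral_add_left (by fun_prop),
            lintegral_const_mul _ hPm, setLIntegral_const]
          ring
      _ = _ := by
          rw [ENNReal.inv_mul_cancel h0 ENNReal.ofReal_ne_top, one_mul,
            ENNReal.inv_mul_cancel hB0 hBt, mul_one]
          simp only [scaleAverage, one_mul]
  have hAv : Measurable (scaleAverage μ s 1 1 P) := measurable_scaleAverage hsc _ _ hPm
  have hPI : ∫⁻ x in U, P x ∂μ ≤ _ := hX.lintegral_dyadicPotential_le hU hδ1 hs hN1 hN2 hgm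
  -- The radius factor is 4 λ instead of λ, hence two further doublings.
  have hAI : ∫⁻ x in U, A x ∂μ ≤ _ := hX.lintegral_scaleAverage_le hU hδ1 hs one_pos
    (by positivity) (N := N + 2) (by rw [pow_add]; linarith) (by rw [pow_add]; linarith)
    (by linarith) hgm
  have hPA : ∫⁻ x in U, scaleAverage μ s 1 1 P x ∂μ ≤ _ :=
    hX.lintegral_scaleAverage_le hU hδ1 hs one_pos one_pos (N := 3) (by norm_num) (by linarith)
      (by linarith) hPm
  calc _ ≤ ∫⁻ x in U, ((β 1 * τ 1 * P x + 4 * τ 1 * (1 + β 1 ^ 2) * A x) +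
        2 * (β 1 * τ 1) * scaleAverage μ s 1 1 P x) ∂μ :=
        setLIntegral_mono' hU.measurableSet hpt2
    _ = β 1 * τ 1 * ∫⁻ x in U, P x ∂μ + 4 * τ 1 * (1 + β 1 ^ 2) * ∫⁻ x in U, A x ∂μ +
        2 * (β 1 * τ 1) * ∫⁻ x in U, scaleAverage μ s 1 1 P x ∂μ := by
        rw [lintegral_add_left (by fun_prop), lintegral_add_left (by fun_prop),
          lintegral_const_mul _ hPm, lintegral_const_mul _ hAm, lintegral_const_mul _ hAv]
    _ ≤ β 1 * τ 1 * (2 * (β 1 : ℝ≥0∞) ^ N * ∫⁻ x in U, g x ∂μ) +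
        4 * τ 1 * (1 + β 1 ^ 2) * ((β 1 : ℝ≥0∞) ^ (N + 2) * ∫⁻ x in U, g x ∂μ) +
        2 * (β 1 * τ 1) * ((β 1 : ℝ≥0∞) ^ 3 * (2 * (β 1 : ℝ≥0∞) ^ N * ∫⁻ x in U, g x ∂μ)) := by
        gcongr
        exact hPA.trans (by gcongr)
    _ = _ := by rw [hI]; ring

end IsPISpace

end BVSlices

namespace BVSlices

/-! ### Semicontinuity and slicing of the nonlocal energy -/

section KernelEnergy

variable {X : Type u} [MeasurableSpace X] {m : Measure X}
  {k : X → X → ℝ≥0∞} {V : Type*} [NormedAddCommGroup V]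

theorem aemeasurable_kernel_mul_enorm_sub (hk : Measurable fun p : X × X => k p.1 p.2) {h : X → V}
    (hh : AEStronglyMeasurable h m) :
    AEMeasurable (fun p : X × X => k p.1 p.2 * ‖h p.2 - h p.1‖ₑ) (m.prod m) :=
  hk.aemeasurable.mul (hh.comp_snd.sub hh.comp_fst).enorm

theorem kernelEnergy_eq_lintegral_prod [SFinite m] (hk : Measurable fun p : X × X => k p.1 p.2) {h : X → V}
    (hh : AEStronglyMeasurable h m) :
    kernelEnergy m k h = ∫⁻ p, k p.1 p.2 * ‖h p.2 - h p.1‖ₑ ∂(m.prod m) :=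
  (lintegral_prod _ (aemeasurable_kernel_mul_enorm_sub hk hh)).symm

theorem kernelEnergy_congr_ae {h h' : X → V} (hh : h =ᵐ[m] h') :
    kernelEnergy m k h = kernelEnergy m k h' := by
  refine lintegral_congr_ae ?_
  filter_upwards [hh] with x hx
  refine lintegral_congr_ae ?_
  filter_upwards [hh] with z hz
  rw [hx, hz]

/-- A subsequence converges almost everywhere, so the integrands converge at almost every pair, and
Fatou applies on the product. -/
theorem kernelEnergy_le_of_tendsto [SFinite m] (hk : Measurable fun p : X × X => k p.1 p.2) {h : X → V}
    (hh : AEStronglyMeasurable h m) {H : ℕ → X → V} (hH : ∀ i, AEStronglyMeasurable (H i) m)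
    (hlim : Tendsto (fun i => ∫⁻ x, ‖H i x - h x‖ₑ ∂m) atTop (𝓝 0)) {b : ℝ≥0∞}
    (hb : ∀ i, kernelEnergy m k (H i) ≤ b) : kernelEnergy m k h ≤ b := by
  have hmeas : TendstoInMeasure m H atTop h := by
    refine tendstoInMeasure_of_tendsto_eLpNorm one_ne_zero hH hh ?_
    simpa only [eLpNorm_one_eq_lintegral_enorm, Pi.sub_apply] using hlim
  obtain ⟨φ, -, hφ⟩ := hmeas.exists_seq_tendsto_ae
  have hp : ∀ᵐ p ∂(m.prod m), k p.1 p.2 * ‖h p.2 - h p.1‖ₑ ≤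
      liminf (fun j => k p.1 p.2 * ‖H (φ j) p.2 - H (φ j) p.1‖ₑ) atTop := by
    filter_upwards [Measure.quasiMeasurePreserving_fst.ae hφ,
      Measure.quasiMeasurePreserving_snd.ae hφ] with p h1 h2
    -- The kernel may be ∞, and multiplication by ∞ is not continuous at 0; there the inequality is
    -- trivial.
    rcases eq_or_ne ‖h p.2 - h p.1‖ₑ 0 with h0 | h0
    · rw [h0, mul_zero]
      exact zero_le
    · exact (ENNReal.Tendsto.const_mul (h2.sub h1).enorm (Or.inl h0)).liminf_eq.ge
  rw [kernelEnergy_eq_lintegral_prod hk hh]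
  refine (lintegral_mono_ae hp).trans ((lintegral_liminf_le' fun j =>
    aemeasurable_kernel_mul_enorm_sub hk (hH (φ j))).trans ?_)
  refine liminf_le_of_frequently_le' (Frequently.of_forall fun j => ?_)
  rw [← kernelEnergy_eq_lintegral_prod hk (hH (φ j))]
  exact hb (φ j)

end KernelEnergy

section Variation

variable {X : Type u} [MetricSpace X] [MeasurableSpace X] [BorelSpace X]
  [SecondCountableTopology X] {μ : Measure X} [SFinite μ] {U : Set X} {k : X → X → ℝ≥0∞}
  {V : Type*} [NormedAddCommGroup V]

/-- For any b above the liminf of an approximating sequence, a subsequence has energies at most C b,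
and lower semicontinuity carries this bound to h. -/
theorem kernelEnergy_le_variation (hU : IsOpen U) (hk : Measurable fun p : X × X => k p.1 p.2)
    {C : ℝ≥0} (hC : C ≠ 0) (hkC : ∀ F : X → V, LocallyLipschitzOn U F →
      kernelEnergy (μ.restrict U) k F ≤ C * ∫⁻ x in U, pointwiseLip F x ∂μ) {h : X → V}
    (hh : AEStronglyMeasurable h (μ.restrict U)) :
    kernelEnergy (μ.restrict U) k h ≤ C * variation μ U h := by
  have hC' : (C : ℝ≥0∞) ≠ 0 := by simpa using hC
  have key : kernelEnergy (μ.restrict U) k h / C ≤ variation μ U h := by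
    refine le_iInf₂ fun H hH => le_of_forall_gt_imp_ge_of_dense fun b hb => ?_
    obtain ⟨φ, hφ, hφb⟩ := extraction_of_frequently_atTop (frequently_lt_of_liminf_lt
      (by isBoundedDefault) hb)
    refine ENNReal.div_le_of_le_mul ?_
    rw [mul_comm]
    refine kernelEnergy_le_of_tendsto hk hh (H := fun j => H (φ j))
      (fun j => (hH.1 (φ j)).continuousOn.aestronglyMeasurable hU.measurableSet)
      (hH.2.comp hφ.tendsto_atTop) fun j => (hkC _ (hH.1 (φ j))).trans ?_
    gcongr
    exact (hφb j).le
  rwa [ENNReal.div_le_iff_le_mul (Or.inl hC') (Or.inl ENNReal.coe_ne_top), mul_comm] at key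

end Variation

theorem enorm_sub_eq_lintegral_of_ae_eq {Y : Type v} [MeasurableSpace Y] {ν : Measure Y} {f g : Y →₁[ν] ℝ} {F G : Y → ℝ} (hf : F =ᵐ[ν] f)
    (hg : G =ᵐ[ν] g) : ‖f - g‖ₑ = ∫⁻ y, ‖F y - G y‖ₑ ∂ν := by
  rw [Lp.enorm_def, eLpNorm_one_eq_lintegral_enorm]
  refine lintegral_congr_ae ?_
  filter_upwards [hf, hg, Lp.coeFn_sub f g] with y a b e
  rw [e, Pi.sub_apply, a, b]

section Slicing

variable {X : Type u} [MeasurableSpace X] {m : Measure X}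
  {Y : Type v} [MeasurableSpace Y] {ν : Measure Y} [SFinite ν] {k : X → X → ℝ≥0∞}

theorem integrable_slice (f : X →₁[m] (Y →₁[ν] ℝ)) (y : Y) : Integrable (slice f y) m := by
  unfold slice
  split_ifs with h
  · exact h
  · exact integrable_zero _ _ _

/-- By Fubini the default value 0 in `slice` occurs only for a null set of y. -/
theorem slice_ae_eq [SFinite m] (f : X →₁[m] (Y →₁[ν] ℝ)) {H : X × Y → ℝ}
    (hH : jointRep f =ᵐ[m.prod ν] H) : ∀ᵐ y ∂ν, slice f y =ᵐ[m] fun x => H (x, y) := by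
  have h1 := (jointRep_spec f).1.prod_left_ae
  have h2 : ∀ᵐ q ∂(ν.prod m), jointRep f q.swap = H q.swap :=
    Measure.measurePreserving_swap.quasiMeasurePreserving.ae hH
  filter_upwards [h1, Measure.ae_ae_of_ae_prod h2] with y hy hy2
  rw [slice, if_pos hy]
  exact hy2

/-- The nonlocal energy of `f ∈ L¹(X, L¹(Y))` is the integral of the energies of its slices. -/
theorem kernelEnergy_eq_lintegral_slice [SFinite m]
    (hk : Measurable fun p : X × X => k p.1 p.2)
    (f : X →₁[m] (Y →₁[ν] ℝ)) :
    AEMeasurable (fun y => kernelEnergy m k (slice f y)) ν ∧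
      kernelEnergy m k f = ∫⁻ y, kernelEnergy m k (slice f y) ∂ν := by
  have hrep := jointRep_spec f
  -- A genuinely measurable representative is taken so that the integrand is jointly measurable on
  -- (X × X) × Y.
  obtain ⟨H, hHm, hH⟩ := hrep.1.aestronglyMeasurable
  have hHm' : Measurable H := hHm.measurable
  have hsl : ∀ᵐ y ∂ν, kernelEnergy m k (slice f y) =
      ∫⁻ p, k p.1 p.2 * ‖H (p.2, y) - H (p.1, y)‖ₑ ∂(m.prod m) := by
    filter_upwards [slice_ae_eq f hH] with y hy
    rw [kernelEnergy_congr_ae hy, kernelEnergy_eq_lintegral_prod hk]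
    exact (hHm'.comp measurable_prodMk_right).aestronglyMeasurable
  have hΦ : Measurable fun q : (X × X) × Y =>
      k q.1.1 q.1.2 * ‖H (q.1.2, q.2) - H (q.1.1, q.2)‖ₑ := by
    refine (hk.comp measurable_fst).mul (Measurable.enorm (Measurable.sub ?_ ?_))
    · exact hHm'.comp ((measurable_snd.comp measurable_fst).prodMk measurable_snd)
    · exact hHm'.comp ((measurable_fst.comp measurable_fst).prodMk measurable_snd)
  have hf : ∀ᵐ x ∂m, (fun y => H (x, y)) =ᵐ[ν] f x := by
    filter_upwards [hrep.2, Measure.ae_ae_of_ae_prod hH] with x h1 h2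
    filter_upwards [h1, h2] with y h3 h4
    rw [← h4, h3]
  refine ⟨⟨_, hΦ.lintegral_prod_left', hsl⟩, ?_⟩
  -- After the integral over Y is moved inside, it is the L¹(Y) norm of f z - f x for almost every
  -- pair.
  rw [lintegral_congr_ae hsl, kernelEnergy_eq_lintegral_prod hk (Lp.aestronglyMeasurable f),
    ← lintegral_lintegral_swap (f := fun (p : X × X) (y : Y) =>
      k p.1 p.2 * ‖H (p.2, y) - H (p.1, y)‖ₑ) hΦ.aemeasurable]
  refine lintegral_congr_ae ?_
  filter_upwards [Measure.quasiMeasurePreserving_fst.ae hf,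
    Measure.quasiMeasurePreserving_snd.ae hf] with p h1 h2
  rw [enorm_sub_eq_lintegral_of_ae_eq h2 h1, lintegral_const_mul]
  exact ((hHm'.comp measurable_prodMk_left).sub (hHm'.comp measurable_prodMk_left)).enorm

end Slicing

end BVSlices

namespace BVSlices

/-! ### Mollification at a variable scale -/

section WeightedMeans

variable {X : Type u} [MeasurableSpace X] {m : Measure X} {V : Type*} [NormedAddCommGroup V]
  [NormedSpace ℝ V] {B : Set X} {a : ℝ}

theorem integrable_smul_of_bounded (hB : MeasurableSet B) {φ : X → ℝ}
    (hφ : AEStronglyMeasurable φ m) (hφa : ∀ z, |φ z| ≤ a) (hφB : ∀ z ∉ B, φ z = 0) {g : X → V}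
    (hg : IntegrableOn g B m) : Integrable (fun z => φ z • g z) m := by
  have h1 : (fun z => φ z • g z) = fun z => φ z • B.indicator g z := by
    funext z
    by_cases hz : z ∈ B
    · rw [indicator_of_mem hz]
    · rw [hφB z hz, zero_smul, zero_smul]
  rw [h1]
  exact ((integrable_indicator_iff hB).2 hg).bdd_smul a hφ (Eventually.of_forall hφa)

theorem norm_integral_smul_le_of_bounded (hB : MeasurableSet B) {φ : X → ℝ}
    (hφa : ∀ z, |φ z| ≤ a) (hφB : ∀ z ∉ B, φ z = 0) {g : X → V} (hg : IntegrableOn g B m) :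
    ‖∫ z, φ z • g z ∂m‖ ≤ a * ∫ z in B, ‖g z‖ ∂m := by
  rw [← integral_indicator hB, ← integral_const_mul]
  refine norm_integral_le_of_norm_le
    (((integrable_indicator_iff hB).2 hg.norm).const_mul a) (Eventually.of_forall fun z => ?_)
  by_cases hz : z ∈ B
  · rw [indicator_of_mem hz, norm_smul]
    exact mul_le_mul_of_nonneg_right (hφa z) (norm_nonneg _)
  · rw [hφB z hz, indicator_of_notMem hz, zero_smul, norm_zero, mul_zero]

/-- The mean of `h` with respect to the weight `φ`. -/
noncomputable def weightedMean (m : Measure X) (φ : X → ℝ) (h : X → V) : V :=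
  (∫ z, φ z ∂m)⁻¹ • ∫ z, φ z • h z ∂m

variable [CompleteSpace V]

theorem weightedMean_sub_const (hB : MeasurableSet B) (hBt : m B ≠ ∞) {φ : X → ℝ}
    (hφ : AEStronglyMeasurable φ m) (hφa : ∀ z, |φ z| ≤ a) (hφB : ∀ z ∉ B, φ z = 0)
    (h0 : ∫ z, φ z ∂m ≠ 0) {h : X → V} (hh : IntegrableOn h B m) (c : V) :
    weightedMean m φ h - c = (∫ z, φ z ∂m)⁻¹ • ∫ z, φ z • (h z - c) ∂m := by
  have h1 := integrable_smul_of_bounded hB hφ hφa hφB hh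
  have h2 := integrable_smul_of_bounded hB hφ hφa hφB (integrableOn_const (C := c) hBt)
  simp only [smul_sub]
  rw [integral_sub h1 h2, integral_smul_const, smul_sub, smul_smul, inv_mul_cancel₀ h0, one_smul]
  rfl

/-- Means reproduce constants, so c may be subtracted from h. With p, q the total weights and I, J
the weighted integrals of h - c, the difference is (I - J) / p + (1 / p - 1 / q) J, and |p - q| ≤ e
m(B). The freedom in c is used later. -/
theorem norm_weightedMean_sub_le (hB : MeasurableSet B) (hBt : m B ≠ ∞) {φ ψ : X → ℝ}
    (hφ : AEStronglyMeasurable φ m) (hψ : AEStronglyMeasurable ψ m) (hφa : ∀ z, |φ z| ≤ a)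
    (hψa : ∀ z, |ψ z| ≤ a) (hφB : ∀ z ∉ B, φ z = 0) (hψB : ∀ z ∉ B, ψ z = 0) {L e : ℝ}
    (hL : 0 < L) (hφL : L ≤ ∫ z, φ z ∂m) (hψL : L ≤ ∫ z, ψ z ∂m) (he : ∀ z, |φ z - ψ z| ≤ e)
    {h : X → V} (hh : IntegrableOn h B m) (c : V) :
    ‖weightedMean m φ h - weightedMean m ψ h‖ ≤
      (e / L + a * e * m.real B / L ^ 2) * ∫ z in B, ‖h z - c‖ ∂m := by
  have hφ0 := hL.trans_le hφL
  have hψ0 := hL.trans_le hψL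
  have hc : IntegrableOn (fun z => h z - c) B m := hh.sub (integrableOn_const hBt)
  have hφψB : ∀ z ∉ B, φ z - ψ z = 0 := fun z hz => by rw [hφB z hz, hψB z hz, sub_zero]
  have h1 := norm_integral_smul_le_of_bounded hB he hφψB hc
  have h2 := norm_integral_smul_le_of_bounded hB hψa hψB hc
  have h3 := norm_integral_smul_le_of_bounded hB he hφψB (integrableOn_const (C := (1 : ℝ)) hBt)
  have i1 := integrable_smul_of_bounded hB hφ hφa hφB hc
  have i2 := integrable_smul_of_bounded hB hψ hψa hψB hc
  have i3 := integrable_smul_of_bounded hB hφ hφa hφB (integrableOn_const (C := (1 : ℝ)) hBt)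
  have i4 := integrable_smul_of_bounded hB hψ hψa hψB (integrableOn_const (C := (1 : ℝ)) hBt)
  simp only [sub_smul] at h1 h3
  rw [integral_sub i1 i2] at h1
  rw [integral_sub i3 i4] at h3
  simp only [smul_eq_mul, mul_one, norm_one, setIntegral_const, Real.norm_eq_abs] at h3
  have h4 : weightedMean m φ h - weightedMean m ψ h =
      (weightedMean m φ h - c) - (weightedMean m ψ h - c) := by abel
  rw [h4, weightedMean_sub_const hB hBt hφ hφa hφB hφ0.ne' hh c,
    weightedMean_sub_const hB hBt hψ hψa hψB hψ0.ne' hh c]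
  set p := ∫ z, φ z ∂m
  set q := ∫ z, ψ z ∂m
  set I := ∫ z, φ z • (h z - c) ∂m
  set J := ∫ z, ψ z • (h z - c) ∂m
  set N := ∫ z in B, ‖h z - c‖ ∂m
  have hN : 0 ≤ N := integral_nonneg fun z => norm_nonneg _
  have h5 : p⁻¹ • I - q⁻¹ • J = p⁻¹ • (I - J) + (p⁻¹ - q⁻¹) • J := by
    rw [smul_sub, sub_smul]; abel
  have hp : |p⁻¹| ≤ L⁻¹ := by
    rw [abs_of_pos (inv_pos.2 hφ0)]
    exact inv_anti₀ hL hφL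
  have hq : |q⁻¹| ≤ L⁻¹ := by
    rw [abs_of_pos (inv_pos.2 hψ0)]
    exact inv_anti₀ hL hψL
  have hpq : |p⁻¹ - q⁻¹| ≤ L⁻¹ * L⁻¹ * (e * m.real B) := by
    have : p⁻¹ - q⁻¹ = p⁻¹ * q⁻¹ * (q - p) := by field_simp
    rw [this, abs_mul, abs_mul, abs_sub_comm]
    gcongr
  rw [h5]
  refine (norm_add_le _ _).trans ?_
  rw [norm_smul, norm_smul, Real.norm_eq_abs, Real.norm_eq_abs]
  have hBr : 0 ≤ m.real B := measureReal_nonneg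
  calc |p⁻¹| * ‖I - J‖ + |p⁻¹ - q⁻¹| * ‖J‖
      ≤ L⁻¹ * (e * N) + L⁻¹ * L⁻¹ * (e * m.real B) * (a * N) := by
        gcongr
        exact (abs_nonneg _).trans hpq
    _ = _ := by
        field_simp

end WeightedMeans

section Mollify

variable {X : Type u} [MetricSpace X]

/-- The tent function of height and radius `s x / 8` about `x`. -/
noncomputable def tent (s : X → ℝ) (x z : X) : ℝ := max 0 (s x / 8 - dist z x)

/-- The mean of `h` with respect to the tent functions at the scale `s`. -/
noncomputable def mollify [MeasurableSpace X] {V : Type*} [NormedAddCommGroup V]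
    [NormedSpace ℝ V] (m : Measure X) (s : X → ℝ) (h : X → V) (x : X) : V :=
  weightedMean m (tent s x) h

theorem tent_nonneg (s : X → ℝ) (x z : X) : 0 ≤ tent s x z := le_max_left _ _

theorem continuous_tent (s : X → ℝ) (x : X) : Continuous (tent s x) :=
  continuous_const.max (continuous_const.sub (continuous_id.dist continuous_const))

end Mollify

/-! ### Estimates for tent functions and mollifications -/

namespace IsPISpace

variable {X : Type u} [MetricSpace X] [MeasurableSpace X] {μ : Measure X}
  {β τ : ℝ → ℝ≥0} {lam : ℝ} {U : Set X} {δ : ℝ} {s : X → ℝ}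

theorem measureReal_ball_le (hX : IsPISpace μ β τ lam) {x z : X} {r t : ℝ} (ht : 0 < t) (n : ℕ)
    (hn : 2 ^ n * t ≤ 2) (hr : dist z x + r ≤ 2 ^ n * t) :
    μ.real (Metric.ball z r) ≤ (β 1 : ℝ) ^ n * μ.real (Metric.ball x t) := by
  have h1 := ENNReal.toReal_mono (ENNReal.mul_ne_top (by finiteness)
    (hX.measure_ball_ne_top x t)) (hX.measure_ball_le ht n hn hr)
  simpa [measureReal_def] using h1

theorem abs_scale_sub_le (hX : IsPISpace μ β τ lam) (hs : IsScale U lam δ s) (x y : X) :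
    |s x - s y| ≤ dist x y / 128 := by
  have h1 := hs.abs_sub_le x y
  have h2 : 128 * 1 * |s x - s y| ≤ 128 * lam * |s x - s y| := by
    gcongr
    exact hX.one_le_dilation
  linarith

theorem ball_subset_of_isScale (hX : IsPISpace μ β τ lam) (hs : IsScale U lam δ s) {x : X}
    (hx : x ∈ U) {r : ℝ} (hr : r ≤ 64 * s x) : Metric.ball x r ⊆ U := by
  refine (Metric.ball_subset_closedBall.trans (Metric.closedBall_subset_closedBall
    (hr.trans ?_))).trans (hs.closedBall_subset x hx)
  have := hX.one_le_dilation
  have hsx := hs.pos x hx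
  nlinarith

theorem scale_le (hX : IsPISpace μ β τ lam) (hs : IsScale U lam δ s) {x : X} (hx : x ∈ U) :
    128 * s x ≤ δ := by
  refine le_trans ?_ (hs.le x)
  have := hX.one_le_dilation
  have hsx := hs.pos x hx
  nlinarith

theorem doubling_constant_pos (hX : IsPISpace μ β τ lam) (x : X) : 0 < (β 1 : ℝ) := by
  have h1 := hX.doubling 1 1 x one_pos le_rfl
  have h2 := hX.ball_pos x (2 * 1) (by norm_num)
  have h3 : β 1 ≠ 0 := by
    intro h0
    rw [h0] at h1
    simp at h1
    simp [h1] at h2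
  exact_mod_cast pos_iff_ne_zero.2 h3

theorem abs_tent_le (hX : IsPISpace μ β τ lam) (hs : IsScale U lam δ s) {y x : X} (hy : y ∈ U)
    (hx : dist x y ≤ s y / 16) (z : X) : |tent s x z| ≤ s y / 4 := by
  have hsy := hs.pos y hy
  have h1 := hX.abs_scale_sub_le hs x y
  rw [abs_le] at h1
  rw [abs_of_nonneg (tent_nonneg s x z)]
  exact max_le (by positivity) (by linarith [dist_nonneg (x := z) (y := x)])

/-- All tents with centres near y are supported in one ball about y, so their means can be compared
there. -/
theorem tent_eq_zero (hX : IsPISpace μ β τ lam) (hs : IsScale U lam δ s) {y x : X} (hy : y ∈ U)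
    (hx : dist x y ≤ s y / 16) {z : X} (hz : z ∉ Metric.ball y (3 * s y / 8)) :
    tent s x z = 0 := by
  have hsy := hs.pos y hy
  have h1 := hX.abs_scale_sub_le hs x y
  rw [abs_le] at h1
  rw [Metric.mem_ball, not_lt] at hz
  have := dist_triangle z x y
  exact max_eq_left (by linarith)

theorem abs_tent_sub_le (hX : IsPISpace μ β τ lam) (hs : IsScale U lam δ s) (x x' z : X) :
    |tent s x z - tent s x' z| ≤ 2 * dist x x' := by
  have h1 := hX.abs_scale_sub_le hs x x'
  have h2 := abs_dist_sub_le x x' z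
  refine (abs_max_sub_max_le_max _ _ _ _).trans (max_le (by simp) ?_)
  rw [dist_comm z x, dist_comm z x']
  rw [abs_le] at *
  constructor <;> linarith [dist_nonneg (x := x) (y := x')]

variable [BorelSpace X]

/-- The tent is at least s y / 32 on the ball of radius s y / 32 about x. Four doublings give radius
s y / 2, which exceeds 1/16 + 3/8 times s y and so covers the ball about y. -/
theorem le_integral_tent (hX : IsPISpace μ β τ lam) (hδ1 : δ ≤ 1) (hs : IsScale U lam δ s)
    {y x : X} (hy : y ∈ U) (hx : dist x y ≤ s y / 16)
    (hint : Integrable (tent s x) (μ.restrict U)) :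
    s y / 32 * μ.real (Metric.ball y (3 * s y / 8)) ≤
      (β 1 : ℝ) ^ 4 * ∫ z, tent s x z ∂(μ.restrict U) := by
  have hsy := hs.pos y hy
  have hsc := hX.scale_le hs hy
  have h1 := hX.abs_scale_sub_le hs x y
  rw [abs_le] at h1
  have h2 : μ.real (Metric.ball y (3 * s y / 8)) ≤
      (β 1 : ℝ) ^ 4 * μ.real (Metric.ball x (s y / 32)) := by
    refine hX.measureReal_ball_le (by positivity) 4 (by linarith) ?_
    rw [dist_comm]
    linarith
  have hsub : Metric.ball x (s y / 32) ⊆ U :=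
    (Metric.ball_subset_ball' (by linarith)).trans
      (hX.ball_subset_of_isScale hs hy (r := s y) (by linarith))
  have h3 : s y / 32 * μ.real (Metric.ball x (s y / 32)) ≤
      ∫ z, tent s x z ∂(μ.restrict U) := by
    have h4 : μ.real (Metric.ball x (s y / 32)) =
        (μ.restrict U).real (Metric.ball x (s y / 32)) := by
      rw [measureReal_restrict_apply Metric.isOpen_ball.measurableSet, inter_eq_left.2 hsub]
    have ht : (μ.restrict U) (Metric.ball x (s y / 32)) ≠ ∞ :=
      ne_top_of_le_ne_top (hX.measure_ball_ne_top x _) (Measure.restrict_apply_le _ _)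
    rw [h4, mul_comm, ← smul_eq_mul, ← integral_indicator_const _ Metric.isOpen_ball.measurableSet]
    refine integral_mono ((integrable_indicator_iff Metric.isOpen_ball.measurableSet).2
      (integrableOn_const ht)) hint fun z => ?_
    by_cases hz : z ∈ Metric.ball x (s y / 32)
    · simp only [indicator_of_mem hz]
      refine le_max_of_le_right ?_
      have : dist z x < s y / 32 := hz
      linarith
    · simp only [indicator_of_notMem hz]
      exact le_max_left _ _
  calc _ ≤ s y / 32 * ((β 1 : ℝ) ^ 4 * μ.real (Metric.ball x (s y / 32))) := by gcongr
    _ = (β 1 : ℝ) ^ 4 * (s y / 32 * μ.real (Metric.ball x (s y / 32))) := by ring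
    _ ≤ _ := by gcongr

variable {V : Type*} [NormedAddCommGroup V] [NormedSpace ℝ V] [CompleteSpace V]

theorem integrable_tent (hX : IsPISpace μ β τ lam) (hs : IsScale U lam δ s) {y x : X}
    (hy : y ∈ U) (hx : dist x y ≤ s y / 16) : Integrable (tent s x) (μ.restrict U) := by
  have ht : (μ.restrict U) (Metric.ball y (3 * s y / 8)) ≠ ∞ :=
    ne_top_of_le_ne_top (hX.measure_ball_ne_top y _) (Measure.restrict_apply_le _ _)
  simpa using integrable_smul_of_bounded Metric.isOpen_ball.measurableSet
    (continuous_tent s x).aestronglyMeasurable (hX.abs_tent_le hs hy hx)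
    (fun z hz => hX.tent_eq_zero hs hy hx hz) (integrableOn_const (C := (1 : ℝ)) ht)

/-- This is `norm_weightedMean_sub_le` with height a = s y / 4, weight difference e = 2 dist x x'
and mass L = s y μ(B) / (32 κ ^ 4); the two terms give 64 κ ^ 4 and 512 κ ^ 8. -/
theorem norm_mollify_sub_le (hX : IsPISpace μ β τ lam) (hδ1 : δ ≤ 1) (hs : IsScale U lam δ s)
    {h : X → V} (hh : IntegrableOn h U μ) {y x x' : X} (hy : y ∈ U) (hx : dist x y ≤ s y / 16)
    (hx' : dist x' y ≤ s y / 16) (c : V) :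
    ‖mollify (μ.restrict U) s h x - mollify (μ.restrict U) s h x'‖ ≤
      ((64 * β 1 ^ 4 + 512 * β 1 ^ 8) / (s y * μ.real (Metric.ball y (3 * s y / 8))) *
        ∫ z in Metric.ball y (3 * s y / 8), ‖h z - c‖ ∂μ) * dist x x' := by
  have hsy := hs.pos y hy
  have hκ := hX.doubling_constant_pos y
  set B := Metric.ball y (3 * s y / 8) with hB
  have hBm : MeasurableSet B := Metric.isOpen_ball.measurableSet
  have hBU : B ⊆ U := hX.ball_subset_of_isScale hs hy (by linarith)
  have hrr : (μ.restrict U).restrict B = μ.restrict B := by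
    rw [Measure.restrict_restrict hBm, inter_eq_left.2 hBU]
  have hreal : (μ.restrict U).real B = μ.real B := by
    rw [measureReal_restrict_apply hBm, inter_eq_left.2 hBU]
  have hBt : (μ.restrict U) B ≠ ∞ :=
    ne_top_of_le_ne_top (hX.measure_ball_ne_top y _) (Measure.restrict_apply_le _ _)
  have hB0 : 0 < μ.real B := ENNReal.toReal_pos (hX.measure_ball_ne_zero y (by positivity))
    (hX.measure_ball_ne_top y _)
  have i1 := hX.le_integral_tent hδ1 hs hy hx (hX.integrable_tent hs hy hx)
  have i2 := hX.le_integral_tent hδ1 hs hy hx' (hX.integrable_tent hs hy hx')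
  have key := norm_weightedMean_sub_le hBm hBt (continuous_tent s x).aestronglyMeasurable
    (continuous_tent s x').aestronglyMeasurable (hX.abs_tent_le hs hy hx)
    (hX.abs_tent_le hs hy hx') (fun z hz => hX.tent_eq_zero hs hy hx hz)
    (fun z hz => hX.tent_eq_zero hs hy hx' hz)
    (L := s y / 32 * μ.real B / (β 1 : ℝ) ^ 4) (by positivity)
    (by rw [div_le_iff₀' (by positivity)]; exact i1)
    (by rw [div_le_iff₀' (by positivity)]; exact i2)
    (hX.abs_tent_sub_le hs x x') (h := h) (Integrable.integrableOn hh) c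
  rw [hrr, hreal] at key
  refine key.trans (le_of_eq ?_)
  field_simp
  ring

theorem locallyLipschitzOn_mollify (hX : IsPISpace μ β τ lam) (hδ1 : δ ≤ 1)
    (hs : IsScale U lam δ s) {h : X → V} (hh : IntegrableOn h U μ) :
    LocallyLipschitzOn U (mollify (μ.restrict U) s h) := by
  intro y hy
  have hsy := hs.pos y hy
  refine ⟨Real.toNNReal ((64 * β 1 ^ 4 + 512 * β 1 ^ 8) /
      (s y * μ.real (Metric.ball y (3 * s y / 8))) *
        ∫ z in Metric.ball y (3 * s y / 8), ‖h z - 0‖ ∂μ), Metric.ball y (s y / 16),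
    mem_nhdsWithin_of_mem_nhds (Metric.ball_mem_nhds y (by positivity)),
    LipschitzOnWith.of_dist_le_mul fun x hx x' hx' => ?_⟩
  rw [dist_eq_norm, Real.coe_toNNReal _ (by positivity)]
  exact hX.norm_mollify_sub_le hδ1 hs hh hy (Metric.mem_ball.1 hx).le (Metric.mem_ball.1 hx').le 0

theorem pointwiseLip_mollify_le (hX : IsPISpace μ β τ lam) (hδ1 : δ ≤ 1) (hs : IsScale U lam δ s)
    {h : X → V} (hh : IntegrableOn h U μ) {y : X} (hy : y ∈ U) (c : V) :
    pointwiseLip (mollify (μ.restrict U) s h) y ≤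
      (64 * β 1 ^ 4 + 512 * β 1 ^ 8) * ((ENNReal.ofReal (s y))⁻¹ *
        ((μ (Metric.ball y (3 / 8 * s y)))⁻¹ *
          ∫⁻ z in Metric.ball y (3 / 8 * s y), ‖h z - c‖ₑ ∂μ)) := by
  have hsy := hs.pos y hy
  rw [show 3 / 8 * s y = 3 * s y / 8 by ring]
  have hBU : Metric.ball y (3 * s y / 8) ⊆ U := hX.ball_subset_of_isScale hs hy (by linarith)
  have hB0 := hX.measure_ball_ne_zero y (by positivity : 0 < 3 * s y / 8)
  have hBt := hX.measure_ball_ne_top y (3 * s y / 8)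
  have hB0' : 0 < μ.real (Metric.ball y (3 * s y / 8)) := ENNReal.toReal_pos hB0 hBt
  have hi : IntegrableOn (fun z => h z - c) (Metric.ball y (3 * s y / 8)) μ :=
    (hh.mono_set hBU).sub (integrableOn_const hBt)
  refine pointwiseLip_le_of_eventually ?_
  filter_upwards [Metric.ball_mem_nhds y (by positivity : 0 < s y / 16)] with x hx
  have key := hX.norm_mollify_sub_le hδ1 hs hh hy (x := y) (x' := x) (by simp; positivity)
    (Metric.mem_ball.1 hx).le c
  rw [edist_eq_enorm_sub, ← ofReal_norm]
  refine (ENNReal.ofReal_le_ofReal key).trans (le_of_eq ?_)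
  rw [ENNReal.ofReal_mul' dist_nonneg, ← edist_dist, ENNReal.ofReal_mul (by positivity),
    ENNReal.ofReal_div_of_pos (by positivity), ENNReal.ofReal_mul hsy.le,
    ofReal_integral_norm_eq_lintegral_enorm hi, measureReal_def, ENNReal.ofReal_toReal hBt,
    ENNReal.div_eq_inv_mul, ENNReal.mul_inv (Or.inr hBt) (Or.inl ENNReal.ofReal_ne_top)]
  have hκ : ENNReal.ofReal (64 * (β 1 : ℝ) ^ 4 + 512 * (β 1 : ℝ) ^ 8) =
      64 * (β 1 : ℝ≥0∞) ^ 4 + 512 * (β 1 : ℝ≥0∞) ^ 8 := by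
    rw [ENNReal.ofReal_add (by positivity) (by positivity), ENNReal.ofReal_mul (by norm_num),
      ENNReal.ofReal_mul (by norm_num), ENNReal.ofReal_pow (by positivity),
      ENNReal.ofReal_pow (by positivity), ENNReal.ofReal_coe_nnreal]
    simp
  rw [hκ]
  ring

/-- The difference is a weighted mean of h z - h y whose normalized weight is at most 8 κ ^ 4 /
μ(B); two doublings pass to the ball of radius s y. The factor s y offsets the one in the kernel and
later yields L¹ convergence. -/
theorem enorm_mollify_sub_le (hX : IsPISpace μ β τ lam) (hδ1 : δ ≤ 1) (hs : IsScale U lam δ s)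
    {h : X → V} (hh : IntegrableOn h U μ) {y : X} (hy : y ∈ U) :
    ‖mollify (μ.restrict U) s h y - h y‖ₑ ≤ 8 * β 1 ^ 6 * ENNReal.ofReal (s y) *
      ∫⁻ z, scaleKernel μ s y z * ‖h z - h y‖ₑ ∂(μ.restrict U) := by
  have hsy := hs.pos y hy
  have hsc := hX.scale_le hs hy
  have hκ := hX.doubling_constant_pos y
  have hyy : dist y y ≤ s y / 16 := by simp; positivity
  set B := Metric.ball y (3 * s y / 8) with hB
  have hBm : MeasurableSet B := Metric.isOpen_ball.measurableSet
  have hBU : B ⊆ U := hX.ball_subset_of_isScale hs hy (by linarith)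
  have hrr : (μ.restrict U).restrict B = μ.restrict B := by
    rw [Measure.restrict_restrict hBm, inter_eq_left.2 hBU]
  have hB0 := hX.measure_ball_ne_zero y (by positivity : 0 < 3 * s y / 8)
  have hBt := hX.measure_ball_ne_top y (3 * s y / 8)
  have hBt' : (μ.restrict U) B ≠ ∞ := ne_top_of_le_ne_top hBt (Measure.restrict_apply_le _ _)
  have hB0' : 0 < μ.real B := ENNReal.toReal_pos hB0 hBt
  have i1 := hX.le_integral_tent hδ1 hs hy hyy (hX.integrable_tent hs hy hyy)
  set p := ∫ z, tent s y z ∂(μ.restrict U) with hp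
  have hL : 0 < s y / 32 * μ.real B / (β 1 : ℝ) ^ 4 := by positivity
  have hpL : s y / 32 * μ.real B / (β 1 : ℝ) ^ 4 ≤ p := by
    rw [div_le_iff₀' (by positivity)]; exact i1
  have hp0 := hL.trans_le hpL
  have hhB : IntegrableOn h B (μ.restrict U) := Integrable.integrableOn hh
  have hi : IntegrableOn (fun z => h z - h y) B μ :=
    (hh.mono_set hBU).sub (integrableOn_const hBt)
  have hnorm : ‖mollify (μ.restrict U) s h y - h y‖ ≤
      8 * (β 1 : ℝ) ^ 4 / μ.real B * ∫ z in B, ‖h z - h y‖ ∂μ := by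
    have h1 := norm_integral_smul_le_of_bounded (m := μ.restrict U) hBm (hX.abs_tent_le hs hy hyy)
      (fun z hz => hX.tent_eq_zero hs hy hyy hz) (hhB.sub (integrableOn_const (C := h y) hBt'))
    simp only [Pi.sub_apply] at h1
    rw [hrr] at h1
    rw [mollify, weightedMean_sub_const hBm hBt' (continuous_tent s y).aestronglyMeasurable
      (hX.abs_tent_le hs hy hyy) (fun z hz => hX.tent_eq_zero hs hy hyy hz) hp0.ne' hhB (h y),
      norm_smul, Real.norm_eq_abs, ← hp, abs_of_pos (inv_pos.2 hp0)]
    calc _ ≤ (s y / 32 * μ.real B / (β 1 : ℝ) ^ 4)⁻¹ *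
          (s y / 4 * ∫ z in B, ‖h z - h y‖ ∂μ) := by gcongr
      _ = _ := by field_simp; ring
  rw [hX.lintegral_scaleKernel_mul hs hy, ← ofReal_norm]
  refine (ENNReal.ofReal_le_ofReal hnorm).trans ?_
  rw [ENNReal.ofReal_mul (by positivity), ofReal_integral_norm_eq_lintegral_enorm hi,
    ENNReal.ofReal_div_of_pos hB0', measureReal_def, ENNReal.ofReal_toReal hBt,
    ENNReal.ofReal_mul (by norm_num), ENNReal.ofReal_pow (by positivity),
    ENNReal.ofReal_coe_nnreal, ENNReal.ofReal_ofNat]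
  have h0 : ENNReal.ofReal (s y) ≠ 0 := by simpa using hsy
  have hinv : (μ B)⁻¹ ≤ (β 1 : ℝ≥0∞) ^ 2 * (μ (Metric.ball y (s y)))⁻¹ :=
    hX.inv_measure_ball_le (by positivity) hsy 2 (by linarith) (by simp; linarith)
  calc 8 * (β 1 : ℝ≥0∞) ^ 4 / μ B * ∫⁻ z in B, ‖h z - h y‖ₑ ∂μ
      = 8 * (β 1 : ℝ≥0∞) ^ 4 * ((μ B)⁻¹ * ∫⁻ z in B, ‖h z - h y‖ₑ ∂μ) := by
        rw [div_eq_mul_inv]; ring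
    _ ≤ 8 * (β 1 : ℝ≥0∞) ^ 4 * ((β 1 : ℝ≥0∞) ^ 2 * (μ (Metric.ball y (s y)))⁻¹ *
          ∫⁻ z in Metric.ball y (s y), ‖h z - h y‖ₑ ∂μ) := by
        have := lintegral_mono_set (μ := μ) (f := fun z => ‖h z - h y‖ₑ)
          (Metric.ball_subset_ball (x := y) (by linarith : 3 * s y / 8 ≤ s y))
        gcongr
    _ = 8 * (β 1 : ℝ≥0∞) ^ 6 * (ENNReal.ofReal (s y) * (ENNReal.ofReal (s y))⁻¹) *
          ((μ (Metric.ball y (s y)))⁻¹ *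
          ∫⁻ z in Metric.ball y (s y), ‖h z - h y‖ₑ ∂μ) := by
        rw [ENNReal.mul_inv_cancel h0 ENNReal.ofReal_ne_top]; ring
    _ = _ := by ring

theorem lintegral_enorm_mollify_sub_le (hX : IsPISpace μ β τ lam) (hU : IsOpen U) (hδ1 : δ ≤ 1)
    (hs : IsScale U lam δ s) {h : X → V} (hh : IntegrableOn h U μ) :
    ∫⁻ x in U, ‖mollify (μ.restrict U) s h x - h x‖ₑ ∂μ ≤ 8 * β 1 ^ 6 * ENNReal.ofReal δ *
      kernelEnergy (μ.restrict U) (scaleKernel μ s) h := by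
  rw [kernelEnergy, ← lintegral_const_mul' _ _ (by finiteness)]
  refine setLIntegral_mono' hU.measurableSet fun x hx =>
    (hX.enorm_mollify_sub_le hδ1 hs hh hx).trans ?_
  gcongr
  linarith [hX.scale_le hs hx, hs.pos x hx]

variable [SecondCountableTopology X] [SFinite μ]

/-- The constant c = h w with w in the ball B about y bounds the Lipschitz constant at y by a
multiple of the energy density G w. Averaging over w in B and using the L¹ bound for averages gives
the energy. -/
theorem lintegral_pointwiseLip_mollify_le (hX : IsPISpace μ β τ lam) (hU : IsOpen U) (hδ1 : δ ≤ 1)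
    (hs : IsScale U lam δ s) {h : X → V} (hh : IntegrableOn h U μ) (hm : StronglyMeasurable h) :
    ∫⁻ x in U, pointwiseLip (mollify (μ.restrict U) s h) x ∂μ ≤
      (64 * β 1 ^ 4 + 512 * β 1 ^ 8) * (2 * β 1 ^ 3) * β 1 ^ 3 *
        kernelEnergy (μ.restrict U) (scaleKernel μ s) h := by
  have hlam := hX.one_le_dilation
  have hsc := hs.continuous hlam
  set G : X → ℝ≥0∞ := fun w => ∫⁻ z, scaleKernel μ s w z * ‖h z - h w‖ₑ ∂(μ.restrict U) with hG
  have hjm : Measurable fun p : X × X => ‖h p.2 - h p.1‖ₑ :=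
    ((hm.comp_measurable measurable_snd).sub (hm.comp_measurable measurable_fst)).enorm
  have hGm : Measurable G := ((measurable_scaleKernel hsc).mul hjm).lintegral_prod_right'
  set D : ℝ≥0∞ := 64 * β 1 ^ 4 + 512 * β 1 ^ 8 with hD
  have hDt : D ≠ ∞ := by rw [hD]; finiteness
  have hpt : ∀ y ∈ U, pointwiseLip (mollify (μ.restrict U) s h) y ≤
      D * (2 * β 1 ^ 3) * scaleAverage μ s (3 / 8) (3 / 8) G y := by
    intro y hy
    have hsy := hs.pos y hy
    have hscy := hX.scale_le hs hy
    have hB0 := hX.measure_ball_ne_zero y (by positivity : 0 < 3 / 8 * s y)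
    have hBt := hX.measure_ball_ne_top y (3 / 8 * s y)
    have h0 : ENNReal.ofReal (s y) ≠ 0 := by simpa using hsy
    set B := Metric.ball y (3 / 8 * s y) with hB
    have hBm : MeasurableSet B := Metric.isOpen_ball.measurableSet
    have hBU : B ⊆ U := hX.ball_subset_of_isScale hs hy (by linarith)
    have hw : ∀ w ∈ B, (μ B)⁻¹ * ∫⁻ z in B, ‖h z - h w‖ₑ ∂μ ≤
        2 * β 1 ^ 3 * ENNReal.ofReal (s y) * G w := by
      intro w hw
      have hwU := hBU hw
      have hsw := hs.pos w hwU
      have hd : dist w y < 3 / 8 * s y := hw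
      have h1 := hX.abs_scale_sub_le hs w y
      rw [abs_le] at h1
      have hsub : B ⊆ Metric.ball w (s w) :=
        Metric.ball_subset_ball' (by rw [dist_comm]; linarith)
      have hinv : (μ B)⁻¹ ≤ (β 1 : ℝ≥0∞) ^ 3 * (μ (Metric.ball w (s w)))⁻¹ :=
        hX.inv_measure_ball_le (by positivity) hsw 3 (by linarith) (by linarith)
      have hs2 : ENNReal.ofReal (s w) ≤ 2 * ENNReal.ofReal (s y) := by
        rw [← ENNReal.ofReal_ofNat 2, ← ENNReal.ofReal_mul (by norm_num)]
        exact ENNReal.ofReal_le_ofReal (by linarith)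
      have h0w : ENNReal.ofReal (s w) ≠ 0 := by simpa using hsw
      have hGw : G w = _ := hX.lintegral_scaleKernel_mul hs hwU (fun z => ‖h z - h w‖ₑ)
      set J := ∫⁻ z in Metric.ball w (s w), ‖h z - h w‖ₑ ∂μ
      have hJ : (μ (Metric.ball w (s w)))⁻¹ * J = ENNReal.ofReal (s w) * G w := by
        rw [hGw, ← mul_assoc, ENNReal.mul_inv_cancel h0w ENNReal.ofReal_ne_top, one_mul]
      calc _ ≤ (β 1 : ℝ≥0∞) ^ 3 * (μ (Metric.ball w (s w)))⁻¹ * J := by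
            have := lintegral_mono_set (μ := μ) (f := fun z => ‖h z - h w‖ₑ) hsub
            gcongr
        _ = (β 1 : ℝ≥0∞) ^ 3 * (ENNReal.ofReal (s w) * G w) := by rw [mul_assoc, hJ]
        _ ≤ (β 1 : ℝ≥0∞) ^ 3 * (2 * ENNReal.ofReal (s y) * G w) := by gcongr
        _ = _ := by ring
    have hle : ∀ w ∈ B, pointwiseLip (mollify (μ.restrict U) s h) y ≤
        D * (2 * β 1 ^ 3) * G w := by
      intro w hwB
      calc _ ≤ D * ((ENNReal.ofReal (s y))⁻¹ *
            ((μ B)⁻¹ * ∫⁻ z in B, ‖h z - h w‖ₑ ∂μ)) :=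
            hX.pointwiseLip_mollify_le hδ1 hs hh hy (h w)
        _ ≤ D * ((ENNReal.ofReal (s y))⁻¹ * (2 * β 1 ^ 3 * ENNReal.ofReal (s y) * G w)) := by
            gcongr _ * (_ * ?_)
            exact hw w hwB
        _ = D * (2 * β 1 ^ 3) * ((ENNReal.ofReal (s y))⁻¹ * ENNReal.ofReal (s y)) * G w := by
            ring
        _ = _ := by rw [ENNReal.inv_mul_cancel h0 ENNReal.ofReal_ne_top, mul_one]
    have hav := setLIntegral_mono' (μ := μ) hBm hle
    rw [setLIntegral_const, lintegral_const_mul _ hGm] at hav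
    calc _ = (μ B)⁻¹ * (pointwiseLip (mollify (μ.restrict U) s h) y * μ B) := by
          rw [mul_comm, mul_assoc, ENNReal.mul_inv_cancel hB0 hBt, mul_one]
      _ ≤ (μ B)⁻¹ * (D * (2 * β 1 ^ 3) * ∫⁻ w in B, G w ∂μ) := by gcongr
      _ = _ := by simp only [scaleAverage]; ring
  calc _ ≤ ∫⁻ y in U, D * (2 * β 1 ^ 3) * scaleAverage μ s (3 / 8) (3 / 8) G y ∂μ :=
        setLIntegral_mono' hU.measurableSet hpt
    _ = D * (2 * β 1 ^ 3) * ∫⁻ y in U, scaleAverage μ s (3 / 8) (3 / 8) G y ∂μ :=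
        lintegral_const_mul _ (measurable_scaleAverage hsc _ _ hGm)
    _ ≤ D * (2 * β 1 ^ 3) * (β 1 ^ 3 * ∫⁻ y in U, G y ∂μ) := by
        gcongr
        exact hX.lintegral_scaleAverage_le hU hδ1 hs (by norm_num) (by norm_num) (by norm_num)
          (by linarith) (by linarith) hGm
    _ = _ := by rw [kernelEnergy]; ring

end IsPISpace

end BVSlices

namespace BVSlices

/-! ### Comparison of the variation with the nonlocal energies -/

/-- The constant in the bound of the nonlocal energies by the variation. -/
noncomputable def energyConst (κ τ : ℝ≥0) (N : ℕ) : ℝ≥0 :=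
  κ * τ * (2 * κ ^ N) + 2 * (κ * τ) * (κ ^ 3 * (2 * κ ^ N)) +
    4 * τ * (1 + κ ^ 2) * κ ^ (N + 2) + 1

/-- The constant in the bound of the variation by the nonlocal energies. -/
noncomputable def mollifyConst (κ : ℝ≥0) : ℝ≥0 :=
  (64 * κ ^ 4 + 512 * κ ^ 8) * (2 * κ ^ 3) * κ ^ 3 + 1

/-- The summand 1 ensures positivity even for κ = 0 or τ = 0, so that division by the constant is
allowed. -/
theorem energyConst_pos (κ τ : ℝ≥0) (N : ℕ) : 0 < energyConst κ τ N := by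
  unfold energyConst
  positivity

theorem mollifyConst_pos (κ : ℝ≥0) : 0 < mollifyConst κ := by
  unfold mollifyConst
  positivity

theorem isBV_iff_variation_lt_top {X : Type u} [MetricSpace X] [MeasurableSpace X]
    {V : Type*} [NormedAddCommGroup V] {μ : Measure X} {U : Set X} {h : X → V} :
    IsBV μ U h ↔ IntegrableOn h U μ ∧ variation μ U h < ∞ := by
  simp only [IsBV, variation, iInf_lt_iff, exists_prop]

namespace IsPISpace

variable {X : Type u} [MetricSpace X] [MeasurableSpace X] [BorelSpace X]
  [SecondCountableTopology X] {μ : Measure X} [SFinite μ] {β τ : ℝ → ℝ≥0} {lam : ℝ} {U : Set X}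
  {V : Type*} [NormedAddCommGroup V]

theorem kernelEnergy_scaleKernel_le_variation (hX : IsPISpace μ β τ lam) (hU : IsOpen U) {δ : ℝ}
    {s : X → ℝ} (hδ1 : δ ≤ 1) (hs : IsScale U lam δ s) {N : ℕ} (hN1 : 8 * lam ≤ 2 ^ N)
    (hN2 : 2 ^ N ≤ 16 * lam) {h : X → V} (hh : IntegrableOn h U μ) :
    kernelEnergy (μ.restrict U) (scaleKernel μ s) h ≤
      energyConst (β 1) (τ 1) N * variation μ U h := by
  refine kernelEnergy_le_variation hU (measurable_scaleKernel (hs.continuous hX.one_le_dilation))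
    (energyConst_pos _ _ _).ne' (fun F hF => ?_) hh.1
  refine (hX.kernelEnergy_le_of_locallyLipschitzOn hU hδ1 hs hN1 hN2 hF).trans ?_
  gcongr
  simp only [energyConst]
  push_cast
  exact le_self_add

variable [NormedSpace ℝ V] [CompleteSpace V]

/-- Along a subsequence with energies below b, the mollifications are within a multiple of δ b of h
in L¹, so they are admissible in the relaxation, and their Lipschitz integrals are at most a
multiple of b. -/
theorem variation_le_liminf_kernelEnergy (hX : IsPISpace μ β τ lam) (hU : IsOpen U) {δ : ℕ → ℝ}
    {s : ℕ → X → ℝ} (hδ1 : ∀ n, δ n ≤ 1) (hδ0 : Tendsto δ atTop (𝓝 0))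
    (hs : ∀ n, IsScale U lam (δ n) (s n)) {h : X → V} (hh : IntegrableOn h U μ) :
    variation μ U h ≤ mollifyConst (β 1) *
      liminf (fun n => kernelEnergy (μ.restrict U) (scaleKernel μ (s n)) h) atTop := by
  have hC0 : (mollifyConst (β 1) : ℝ≥0∞) ≠ 0 := by simpa using (mollifyConst_pos (β 1)).ne'
  obtain ⟨h', hm', hae⟩ := hh.1
  have hh' : IntegrableOn h' U μ := hh.congr hae
  simp only [kernelEnergy_congr_ae hae]
  rw [mul_comm, ← ENNReal.div_le_iff_le_mul (Or.inl hC0) (Or.inl ENNReal.coe_ne_top)]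
  refine le_of_forall_gt_imp_ge_of_dense fun b hb => ENNReal.div_le_of_le_mul ?_
  -- The error bound is a multiple of δ b and tends to 0 only for finite b.
  rcases eq_or_ne b ∞ with rfl | hbt
  · rw [ENNReal.top_mul hC0]
    exact le_top
  obtain ⟨φ, hφ, hφb⟩ := extraction_of_frequently_atTop (frequently_lt_of_liminf_lt
    (by isBoundedDefault) hb)
  have happ : IsLipApprox μ U h fun j => mollify (μ.restrict U) (s (φ j)) h' := by
    refine ⟨fun j => hX.locallyLipschitzOn_mollify (hδ1 _) (hs (φ j)) hh', ?_⟩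
    have hle : ∀ j, ∫⁻ x in U, ‖mollify (μ.restrict U) (s (φ j)) h' x - h x‖ₑ ∂μ ≤
        8 * β 1 ^ 6 * ENNReal.ofReal (δ (φ j)) * b := by
      intro j
      have h1 : ∫⁻ x in U, ‖mollify (μ.restrict U) (s (φ j)) h' x - h x‖ₑ ∂μ =
          ∫⁻ x in U, ‖mollify (μ.restrict U) (s (φ j)) h' x - h' x‖ₑ ∂μ := by
        refine lintegral_congr_ae ?_
        filter_upwards [hae] with x hx
        rw [hx]
      rw [h1]
      refine (hX.lintegral_enorm_mollify_sub_le hU (hδ1 _) (hs (φ j)) hh').trans ?_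
      gcongr
      exact (hφb j).le
    refine tendsto_of_tendsto_of_tendsto_of_le_of_le tendsto_const_nhds ?_ (fun _ => zero_le) hle
    have h2 : Tendsto (fun j => ENNReal.ofReal (δ (φ j))) atTop (𝓝 0) := by
      simpa using ENNReal.tendsto_ofReal (hδ0.comp hφ.tendsto_atTop)
    have h3 := ENNReal.Tendsto.mul_const (b := b) (ENNReal.Tendsto.const_mul
      (a := 8 * (β 1 : ℝ≥0∞) ^ 6) h2 (Or.inr (by finiteness))) (Or.inr hbt)
    simpa using h3
  refine (iInf₂_le _ happ).trans (liminf_le_of_frequently_le' (Frequently.of_forall fun j => ?_))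
  refine (hX.lintegral_pointwiseLip_mollify_le hU (hδ1 _) (hs (φ j)) hh' hm').trans ?_
  rw [mul_comm b]
  refine mul_le_mul' ?_ (hφb j).le
  simp only [mollifyConst]
  push_cast
  exact le_self_add

end IsPISpace

end BVSlices

/-! ### Comparison of the two variations -/

theorem mainTheorem6 :
    ∃ c : ℝ≥0 → ℝ≥0 → ℝ → ℝ≥0, (∀ κ τ lam, 0 < c κ τ lam) ∧
      ∀ (X : Type u) [MetricSpace X] [MeasurableSpace X] [BorelSpace X]
        (μ : Measure X) [SigmaFinite μ] (β τ : ℝ → ℝ≥0) (lam : ℝ),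
        BVSlices.IsPISpace μ β τ lam →
        ∀ (Y : Type v) [MeasurableSpace Y] (ν : Measure Y) [SigmaFinite ν]
          (U : Set X), IsOpen U →
          ∀ f : X →₁[μ.restrict U] (Y →₁[ν] ℝ),
            (BVSlices.IsBV μ U f ↔ BVSlices.HasFiniteTotalVariation f) ∧
            (c (β 1) (τ 1) lam : ℝ≥0∞)⁻¹ * BVSlices.variation μ U f
              ≤ BVSlices.totalVariation f ∧
            BVSlices.totalVariation f
              ≤ (c (β 1) (τ 1) lam : ℝ≥0∞) * BVSlices.variation μ U f := by
  -- The number of doublings depends on λ alone, so the constant can be fixed before the space. For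
  -- λ < 1 its value is irrelevant.
  have hN : ∀ lam : ℝ, ∃ N : ℕ, 1 ≤ lam → 8 * lam ≤ 2 ^ N ∧ (2 : ℝ) ^ N ≤ 16 * lam := by
    intro lam
    by_cases hlam : 1 ≤ lam
    · obtain ⟨n, h1, h2⟩ := exists_nat_pow_near (by linarith : 1 ≤ 8 * lam) one_lt_two
      exact ⟨n + 1, fun _ => ⟨h2.le, by rw [pow_succ]; linarith⟩⟩
    · exact ⟨0, fun h => absurd h hlam⟩
  choose N hN using hN
  refine ⟨fun κ τ lam => BVSlices.mollifyConst κ * BVSlices.energyConst κ τ (N lam),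
    fun κ τ lam => mul_pos (BVSlices.mollifyConst_pos _) (BVSlices.energyConst_pos _ _ _), ?_⟩
  intro X _ _ _ μ _ β τ lam hX Y _ ν _ U hU f
  have := BVSlices.secondCountableTopology_of_ball_pos μ hX.ball_pos
  obtain ⟨hN1, hN2⟩ := hN lam hX.one_le_dilation
  have hδ : ∀ n : ℕ, 0 < 1 / ((n : ℝ) + 1) := fun n => by positivity
  have hδ1 : ∀ n : ℕ, 1 / ((n : ℝ) + 1) ≤ 1 := fun n =>
    (div_le_one (by positivity)).2 (by linarith [(Nat.cast_nonneg n : (0 : ℝ) ≤ n)])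
  choose s hs using fun n : ℕ => BVSlices.exists_isScale hU
    (zero_lt_one.trans_le hX.one_le_dilation) (hδ n)
  set C₁ := BVSlices.energyConst (β 1) (τ 1) (N lam) with hC₁
  set C₂ := BVSlices.mollifyConst (β 1) with hC₂
  have hC : ((C₂ * C₁ : ℝ≥0) : ℝ≥0∞) ≠ 0 := by
    simpa using ⟨(BVSlices.mollifyConst_pos (β 1)).ne', (BVSlices.energyConst_pos _ _ _).ne'⟩
  have hfi : IntegrableOn f U μ := L1.integrable_coeFn f
  have hsi : ∀ y, IntegrableOn (BVSlices.slice f y) U μ := BVSlices.integrable_slice f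
  set E : ℕ → ℝ≥0∞ := fun n => BVSlices.kernelEnergy (μ.restrict U)
    (BVSlices.scaleKernel μ (s n)) f with hE
  set e : ℕ → Y → ℝ≥0∞ := fun n y => BVSlices.kernelEnergy (μ.restrict U)
    (BVSlices.scaleKernel μ (s n)) (BVSlices.slice f y) with he
  have hEe : ∀ n, AEMeasurable (e n) ν ∧ E n = ∫⁻ y, e n y ∂ν := fun n =>
    BVSlices.kernelEnergy_eq_lintegral_slice
      (BVSlices.measurable_scaleKernel ((hs n).continuous hX.one_le_dilation)) f
  have hEv : ∀ n, E n ≤ C₁ * BVSlices.variation μ U f := fun n =>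
    hX.kernelEnergy_scaleKernel_le_variation hU (hδ1 n) (hs n) hN1 hN2 hfi
  have hev : ∀ n y, e n y ≤ C₁ * BVSlices.variation μ U (BVSlices.slice f y) := fun n y =>
    hX.kernelEnergy_scaleKernel_le_variation hU (hδ1 n) (hs n) hN1 hN2 (hsi y)
  have hvE : BVSlices.variation μ U f ≤ C₂ * liminf E atTop :=
    hX.variation_le_liminf_kernelEnergy hU hδ1 tendsto_one_div_add_atTop_nhds_zero_nat hs hfi
  have hve : ∀ y, BVSlices.variation μ U (BVSlices.slice f y) ≤
      C₂ * liminf (fun n => e n y) atTop := fun y =>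
    hX.variation_le_liminf_kernelEnergy hU hδ1 tendsto_one_div_add_atTop_nhds_zero_nat hs (hsi y)
  -- Fatou is applied to the slice energies, which are a.e. measurable in y; measurability of the
  -- variation of the slices is never needed, because the lower integral is monotone.
  have hfatou : ∫⁻ y, liminf (fun n => e n y) atTop ∂ν ≤ C₁ * BVSlices.variation μ U f := by
    refine (lintegral_liminf_le' fun n => (hEe n).1).trans ?_
    refine liminf_le_of_frequently_le' (Frequently.of_forall fun n => ?_)
    rw [← (hEe n).2]
    exact hEv n
  have hlower : BVSlices.variation μ U f ≤ (C₂ * C₁ : ℝ≥0) * BVSlices.totalVariation f := by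
    refine hvE.trans ?_
    rw [ENNReal.coe_mul, mul_assoc]
    gcongr
    refine liminf_le_of_frequently_le' (Frequently.of_forall fun n => ?_)
    rw [(hEe n).2, BVSlices.totalVariation, ← lintegral_const_mul' _ _ ENNReal.coe_ne_top]
    exact lintegral_mono (hev n)
  have hupper : BVSlices.totalVariation f ≤ (C₂ * C₁ : ℝ≥0) * BVSlices.variation μ U f := by
    refine (lintegral_mono hve).trans ?_
    rw [lintegral_const_mul' _ _ ENNReal.coe_ne_top, ENNReal.coe_mul, mul_assoc]
    gcongr
  refine ⟨⟨fun hf => ?_, fun hf => ?_⟩, ?_, hupper⟩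
  · have hv := (BVSlices.isBV_iff_variation_lt_top.1 hf).2
    refine ⟨?_, hupper.trans_lt (ENNReal.mul_lt_top ENNReal.coe_lt_top hv)⟩
    have hmeas : AEMeasurable (fun y => liminf (fun n => e n y) atTop) ν := by
      refine ⟨_, Measurable.liminf fun n => (hEe n).1.measurable_mk, ?_⟩
      filter_upwards [ae_all_iff.2 fun n => (hEe n).1.ae_eq_mk] with y hy
      simp only [hy]
    -- Almost everywhere finiteness is read off the measurable majorant liminf e n y, and `hve`
    -- transfers it to the variation.
    have hfin := ae_lt_top' hmeas
      (hfatou.trans_lt (ENNReal.mul_lt_top ENNReal.coe_lt_top hv)).ne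
    filter_upwards [hfin] with y hy
    exact BVSlices.isBV_iff_variation_lt_top.2
      ⟨hsi y, (hve y).trans_lt (ENNReal.mul_lt_top ENNReal.coe_lt_top hy)⟩
  · exact BVSlices.isBV_iff_variation_lt_top.2
      ⟨hfi, hlower.trans_lt (ENNReal.mul_lt_top ENNReal.coe_lt_top hf.2)⟩
  · rw [← ENNReal.div_eq_inv_mul]
    exact ENNReal.div_le_of_le_mul (by rw [mul_comm]; exact hlower)
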